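/- All systems are finite-dimensional and all families are finite. A measurement (POVM) is a family $\{M_a\}$ of positive semidefinite operators with $\sum_a M_a=\mathds 1$; a state is a positive semidefinite operator of trace one. Given states $\{\omega_x\}$ of a system $A'$ (the quantum inputs), a \emph{generalised measurement set} on $A$ with inputs $\{\omega_x\}$ is a family $$M_{a|\omega_x}=\operatorname{tr}_{A'}\big[M_a^{A'A}(\omega_x\otimes\mathds 1^A)\big],$$ where $\{M_a^{A'A}\}$ is a measurement on $A'\otimes A$. A family is \emph{compatible} (with respect to $\{\omega_x\}$) if it has the form $\sum_\lambda \operatorname{tr}[H_{a|\lambda}\,\omega_x]\,G_\lambda$ for all $a,x$, with a measurement $\{G_\lambda\}$ on $A$ and measurements $\{H_{a|\lambda}\}_a$ on $A'$. The \emph{robustness of incompatibility} $R_{\mathrm I}(\{M_{a|\omega_x}\})$ is the infimum of the $r\ge 0$ for which there is a generalised measurement set $\{N_{a|\omega_x}\}$ on $A$ with the same inputs such that $\{(M_{a|\omega_x}+rN_{a|\omega_x})/(1+r)\}$ is compatible. Let $\{\zeta_y\}$ be states of a system $B'$. A \emph{(Buscemi) behaviour} with inputs $\{\omega_x\},\{\zeta_y\}$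 is a family $$p(a,b|\omega_x,\zeta_y)=\operatorname{tr}\big[(M_{a|\omega_x}\otimes M_{b|\zeta_y})\rho\big]$$ for some shared bipartite state $\rho$ and some generalised measurement sets of the two parties with these inputs. It is \emph{local} if $p(a,b|\omega_x,\zeta_y)=\sum_\lambda q(\lambda)\operatorname{tr}[H_{a|\lambda}\omega_x]\operatorname{tr}[K_{b|\lambda}\zeta_y]$ for all $a,b,x,y$, with a probability distribution $q$ and, for each $\lambda$, measurements $\{H_{a|\lambda}\}_a$ on $A'$ and $\{K_{b|\lambda}\}_b$ on $B'$. The \emph{robustness of Buscemi nonlocality} $R_{\mathrm{BN}}(\{p(a,b|\omega_x,\zeta_y)\})$ is the infimum of the $r\ge 0$ for which there is a behaviour $g$ with the same inputs (arising from a shared state on systems of any finite dimensions) such that $(p+rg)/(1+r)$ is local. \textbf{Result.} Let $A$ be a non-zero system, let $\{\omega_x\}$ be a non-empty family of states of $A'$, and let $\{M_{a|\omega_x}\}$ be a generalised measurement set on $A$ with inputs $\{\omega_x\}$. Then the infimum that defines $R_{\mathrm I}(\{M_{a|\omega_x}\})$ is attained; for every shared state $\rho^{AB}$ and every generalised measurement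 set $\{M_{b|\zeta_y}\}$ of Bob the set of $r$ that defines $R_{\mathrm{BN}}(\{p(a,b|\omega_x,\zeta_y)\})$ is non-empty, where $p(a,b|\omega_x,\zeta_y)=\operatorname{tr}[(M_{a|\omega_x}\otimes M_{b|\zeta_y})\rho^{AB}]$; and $$\max_{\rho^{AB},\,\{M_{b|\zeta_y}\}} R_{\mathrm{BN}}\big(\{p(a,b|\omega_x,\zeta_y)\}\big)=R_{\mathrm I}\big(\{M_{a|\omega_x}\}\big).$$ Here the maximum, which is attained, is over all finite-dimensional systems $B$, all states $\rho^{AB}$ of $A\otimes B$, and all generalised measurement sets of Bob on $B$, with arbitrary finite-dimensional $B'$, quantum inputs $\{\zeta_y\}$ and numbers of inputs and outcomes. In particular Buscemi nonlocality is bounded above by incompatibility, and the bound is attained. -/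

import Mathlib

open scoped Matrix Kronecker ComplexOrder

/-- `ρ` is a density operator on the finite-dimensional space with basis indexed by `n`. -/
def IsState {n : Type*} [Fintype n] (ρ : Matrix n n ℂ) : Prop :=
  ρ.PosSemidef ∧ ρ.trace = 1

/-- `M` is a (positive operator-valued) measurement with outcomes in `o`. -/
def IsPOVM {n o : Type*} [Fintype n] [DecidableEq n] [Fintype o]
    (M : o → Matrix n n ℂ) : Prop :=
  (∀ a, (M a).PosSemidef) ∧ ∑ a, M a = 1

/-- `q` is a probability mass function on the finite type `l`. -/
def IsPMF {l : Type*} [Fintype l] (q : l → ℝ) : Prop :=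
  (∀ i, 0 ≤ q i) ∧ ∑ i, q i = 1

/-- Partial trace over the first tensor factor. -/
def partialTraceFst {m n : Type*} [Fintype m] (T : Matrix (m × n) (m × n) ℂ) : Matrix n n ℂ :=
  Matrix.of fun i j => ∑ k, T (k, i) (k, j)

/-- `N a x = tr_{A'} [L a (ω x ⊗ 1)]` for some bipartite measurement `L` on `A' ⊗ A`: the operators
`N a x` form a generalised measurement set with quantum inputs `ω`. -/
def IsGenMeasSet {V A X O : Type*} [Fintype V] [DecidableEq V] [Fintype A] [DecidableEq A]
    [Fintype O] (ω : X → Matrix V V ℂ) (N : O → X → Matrix A A ℂ) : Prop :=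
  ∃ L : O → Matrix (V × A) (V × A) ℂ, IsPOVM L ∧
    ∀ a x, N a x = partialTraceFst (L a * (ω x ⊗ₖ (1 : Matrix A A ℂ)))

/-- The operators `C a x` are obtained from one parent measurement `G`, followed by a measurement
`H l` (depending on the outcome `l`) of the quantum input `ω x`. -/
def IsCompatible {V A X O : Type*} [Fintype V] [DecidableEq V] [Fintype A] [DecidableEq A]
    [Fintype O] (ω : X → Matrix V V ℂ) (C : O → X → Matrix A A ℂ) : Prop :=
  ∃ (k : ℕ) (G : Fin k → Matrix A A ℂ) (H : Fin k → O → Matrix V V ℂ),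
    IsPOVM G ∧ (∀ l, IsPOVM (H l)) ∧
    ∀ a x, C a x = ∑ l, (H l a * ω x).trace • G l

/-- The values `r ≥ 0` for which `M` becomes compatible after mixing with weight `r` of some
generalised measurement set with the same quantum inputs. -/
def incompatibilityFeasible {V A X O : Type*} [Fintype V] [DecidableEq V] [Fintype A]
    [DecidableEq A] [Fintype O] (ω : X → Matrix V V ℂ) (M : O → X → Matrix A A ℂ) : Set ℝ :=
  {r | 0 ≤ r ∧ ∃ N : O → X → Matrix A A ℂ, IsGenMeasSet ω N ∧
    IsCompatible ω fun a x => ((1 + r : ℝ) : ℂ)⁻¹ • (M a x + (r : ℂ) • N a x)}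

/-- Generalised robustness of incompatibility. -/
noncomputable def robustnessI {V A X O : Type*} [Fintype V] [DecidableEq V] [Fintype A]
    [DecidableEq A] [Fintype O] (ω : X → Matrix V V ℂ) (M : O → X → Matrix A A ℂ) : ℝ :=
  sInf (incompatibilityFeasible ω M)

/-- The behaviour `p(a,b|x,y) = tr[(MA a x ⊗ MB b y) ρ]` (for measurement sets and a state this
trace is real). -/
def behaviour {A B X Y O P : Type*} [Fintype A] [Fintype B]
    (MA : O → X → Matrix A A ℂ) (MB : P → Y → Matrix B B ℂ)
    (ρ : Matrix (A × B) (A × B) ℂ) : O → P → X → Y → ℝ :=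
  fun a b x y => ((MA a x ⊗ₖ MB b y) * ρ).trace.re

/-- `p` is a behaviour of the Buscemi scenario with quantum inputs `ω` and `ζ`: it arises from some
shared state and some generalised measurement sets of the two parties. -/
def IsBuscemiBehaviour {V W X Y O P : Type*} [Fintype V] [DecidableEq V] [Fintype W]
    [DecidableEq W] [Fintype O] [Fintype P] (ω : X → Matrix V V ℂ) (ζ : Y → Matrix W W ℂ)
    (p : O → P → X → Y → ℝ) : Prop :=
  ∃ (m n : ℕ) (NA : O → X → Matrix (Fin m) (Fin m) ℂ) (NB : P → Y → Matrix (Fin n) (Fin n) ℂ)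
    (σ : Matrix (Fin m × Fin n) (Fin m × Fin n) ℂ),
    IsGenMeasSet ω NA ∧ IsGenMeasSet ζ NB ∧ IsState σ ∧ p = behaviour NA NB σ

/-- `p` has a local model: classically correlated measurements of the two quantum inputs. -/
def IsBuscemiLocal {V W X Y O P : Type*} [Fintype V] [DecidableEq V] [Fintype W]
    [DecidableEq W] [Fintype O] [Fintype P] (ω : X → Matrix V V ℂ) (ζ : Y → Matrix W W ℂ)
    (p : O → P → X → Y → ℝ) : Prop :=
  ∃ (k : ℕ) (q : Fin k → ℝ) (H : Fin k → O → Matrix V V ℂ) (K : Fin k → P → Matrix W W ℂ),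
    IsPMF q ∧ (∀ l, IsPOVM (H l)) ∧ (∀ l, IsPOVM (K l)) ∧
    ∀ a b x y, p a b x y = ∑ l, q l * (H l a * ω x).trace.re * (K l b * ζ y).trace.re

/-- The values `r ≥ 0` for which `p` becomes local after mixing with weight `r` of some behaviour
with the same quantum inputs. -/
def nonlocalityFeasible {V W X Y O P : Type*} [Fintype V] [DecidableEq V] [Fintype W]
    [DecidableEq W] [Fintype O] [Fintype P] (ω : X → Matrix V V ℂ) (ζ : Y → Matrix W W ℂ)
    (p : O → P → X → Y → ℝ) : Set ℝ :=
  {r | 0 ≤ r ∧ ∃ g : O → P → X → Y → ℝ, IsBuscemiBehaviour ω ζ g ∧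
    IsBuscemiLocal ω ζ fun a b x y => (p a b x y + r * g a b x y) / (1 + r)}

/-- Generalised robustness of Buscemi nonlocality. -/
noncomputable def robustnessBN {V W X Y O P : Type*} [Fintype V] [DecidableEq V] [Fintype W]
    [DecidableEq W] [Fintype O] [Fintype P] (ω : X → Matrix V V ℂ) (ζ : Y → Matrix W W ℂ)
    (p : O → P → X → Y → ℝ) : ℝ :=
  sInf (nonlocalityFeasible ω ζ p)

/-- What is varied in the maximisation: a system `B` of any finite dimension `dB`, a state `ρ`
shared between `A` and `B`, and a generalised measurement set `MB` of Bob, with any quantum inputs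
`ζ` (states of a system of any finite dimension `dW`, labelled by `Fin i`) and any number `o` of
outcomes. -/
structure BobChoice (A : Type*) [Fintype A] where
  dB : ℕ
  dW : ℕ
  i : ℕ
  o : ℕ
  ρ : Matrix (A × Fin dB) (A × Fin dB) ℂ
  ζ : Fin i → Matrix (Fin dW) (Fin dW) ℂ
  MB : Fin o → Fin i → Matrix (Fin dB) (Fin dB) ℂ
  ρ_state : IsState ρ
  ζ_state : ∀ y, IsState (ζ y)
  MB_gen : IsGenMeasSet ζ MB

/-! `GenCone` and `SepCone` are homogeneous versions of generalised measurement sets and compatible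
families. Both are closed under sums, nonnegative scaling and conjugation `R * · * Rᴴ`, and each
family determines its total, because the inputs have trace one. The least noise weight exists by
compactness; the unbounded number of parent outcomes is handled by Carathéodory's theorem.

Upper bound (`incompatibilityFeasible_subset_nonlocalityFeasible`): if M mixed with N is compatible,
let Alice use N to produce the noise behaviour. Her parent measurement steers Bob to conditional
states, each of which turns his measurement into one of his input alone. So the mixture is local
with the same r.

Lower bound: minimax (`exists_isState_le_trace_dominatingTotals`) yields one state ρ on A with
tr(Zρ) ≥ 1 + R_I for every total Z of a compatible family dominating M. The parties share a
purification of ρ, and Bob measures his input jointly with his half in a maximally entangled basis.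
As in teleportation, each of the d² outcomes moves the ensemble steered by Alice onto Bob's input
space, up to a unitary and a factor 1/d. Tomographically complete inputs turn a local model of p +
rg into operator identities. Undoing √ρ by its pseudo-inverse and averaging gives PMP + N = C, with
P the support projection of ρ and a total satisfying tr(Zρ) ≤ 1 + r. Finally `genCone_pinching_sub`
dominates M by (1+η)PMP plus a multiple of 1 - P, which ρ does not see; as η → 0 this gives R_I ≤ r.
-/

set_option linter.unusedSectionVars false

/-! ### Positivity, traces and contraction of a tensor factor -/

section Positivity

variable {S T n : Type*} [Fintype T] [Fintype n]

theorem Matrix.PosSemidef.exists_eq_conjTranspose_mul_self {A : Matrix n n ℂ}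
    (hA : A.PosSemidef) : ∃ C : Matrix n n ℂ, A = Cᴴ * C := by
  classical
  open scoped MatrixOrder in
  exact CStarAlgebra.nonneg_iff_eq_star_mul_self.mp hA.nonneg

theorem Matrix.PosSemidef.trace_mul_nonneg {A B : Matrix n n ℂ} (hA : A.PosSemidef)
    (hB : B.PosSemidef) : 0 ≤ (A * B).trace := by
  obtain ⟨C, rfl⟩ := hB.exists_eq_conjTranspose_mul_self
  rw [← Matrix.mul_assoc, Matrix.trace_mul_comm, ← Matrix.mul_assoc]
  exact (hA.mul_mul_conjTranspose_same C).trace_nonneg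

theorem Matrix.PosSemidef.ofReal_re_trace {A : Matrix n n ℂ} (hA : A.PosSemidef) :
    ((A.trace.re : ℝ) : ℂ) = A.trace :=
  (Complex.eq_re_of_ofReal_le (r := 0) (by simpa using hA.trace_nonneg)).symm

theorem Matrix.PosSemidef.ofReal_re_trace_mul {A B : Matrix n n ℂ} (hA : A.PosSemidef)
    (hB : B.PosSemidef) : (((A * B).trace.re : ℝ) : ℂ) = (A * B).trace :=
  (Complex.eq_re_of_ofReal_le (r := 0) (by simpa using hA.trace_mul_nonneg hB)).symm

theorem Matrix.PosSemidef.re_trace_nonneg {A : Matrix n n ℂ} (hA : A.PosSemidef) :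
    0 ≤ A.trace.re := (Complex.nonneg_iff.mp hA.trace_nonneg).1

theorem Matrix.PosSemidef.re_trace_mul_nonneg {A B : Matrix n n ℂ} (hA : A.PosSemidef)
    (hB : B.PosSemidef) : 0 ≤ (A * B).trace.re :=
  (Complex.nonneg_iff.mp (hA.trace_mul_nonneg hB)).1

theorem Matrix.PosSemidef.ofReal_smul {A : Matrix S S ℂ} (hA : A.PosSemidef) {c : ℝ}
    (hc : 0 ≤ c) : ((c : ℂ) • A).PosSemidef :=
  hA.smul (Complex.zero_le_real.mpr hc)

/-- Contraction of the second tensor factor of `L` with `σ`, that is `tr_T [L (1 ⊗ σ)]`. -/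
def slice (L : Matrix (S × T) (S × T) ℂ) (σ : Matrix T T ℂ) : Matrix S S ℂ :=
  Matrix.of fun s s' => ∑ t, ∑ t', L (s, t) (s', t') * σ t' t

/-- Writing σ = C†C puts the contraction in Kraus form, with one operator 1 ⊗ (row k of C) for each
k. -/
theorem slice_posSemidef [Fintype S] {L : Matrix (S × T) (S × T) ℂ} {σ : Matrix T T ℂ}
    (hL : L.PosSemidef) (hσ : σ.PosSemidef) : (slice L σ).PosSemidef := by
  classical
  obtain ⟨C, rfl⟩ := hσ.exists_eq_conjTranspose_mul_self
  let B : T → Matrix S (S × T) ℂ := fun k => Matrix.of fun s q => if s = q.1 then C k q.2 else 0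
  have h : slice L (Cᴴ * C) = ∑ k, B k * L * (B k)ᴴ := by
    ext s s'
    simp only [slice, Matrix.of_apply, Matrix.sum_apply, Matrix.mul_apply, B,
      Matrix.conjTranspose_apply, Fintype.sum_prod_type, ite_mul, zero_mul, Finset.sum_ite_irrel,
      Finset.sum_const_zero, Finset.sum_ite_eq, Finset.mem_univ, if_true, mul_ite, mul_zero,
      apply_ite star, star_zero]
    simp only [Finset.mul_sum, Finset.sum_mul]
    rw [Finset.sum_comm]
    conv_rhs => rw [Finset.sum_comm]
    refine Finset.sum_congr rfl fun t' _ => ?_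
    rw [Finset.sum_comm]
    exact Finset.sum_congr rfl fun k _ => Finset.sum_congr rfl fun t _ => by ring
  rw [h]
  exact Matrix.posSemidef_sum _ fun k _ => hL.mul_mul_conjTranspose_same _

theorem slice_add (L L' : Matrix (S × T) (S × T) ℂ) (σ : Matrix T T ℂ) :
    slice (L + L') σ = slice L σ + slice L' σ := by
  ext s s'; simp [slice, add_mul, Finset.sum_add_distrib]

theorem slice_sum {ι : Type*} (u : Finset ι) (L : ι → Matrix (S × T) (S × T) ℂ)
    (σ : Matrix T T ℂ) : slice (∑ i ∈ u, L i) σ = ∑ i ∈ u, slice (L i) σ := by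
  classical
  induction u using Finset.induction_on with
  | empty => ext s s'; simp [slice]
  | insert i u hi ih => rw [Finset.sum_insert hi, Finset.sum_insert hi, slice_add, ih]

theorem slice_smul (c : ℂ) (L : Matrix (S × T) (S × T) ℂ) (σ : Matrix T T ℂ) :
    slice (c • L) σ = c • slice L σ := by
  ext s s'; simp [slice, Finset.mul_sum, mul_assoc]

theorem slice_kronecker (P : Matrix S S ℂ) (Q σ : Matrix T T ℂ) :
    slice (P ⊗ₖ Q) σ = (Q * σ).trace • P := by
  ext s s'
  simp only [slice, Matrix.kroneckerMap_apply, Matrix.of_apply, Matrix.smul_apply, smul_eq_mul,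
    Matrix.trace, Matrix.diag, Matrix.mul_apply, Finset.sum_mul]
  exact Finset.sum_congr rfl fun t _ => Finset.sum_congr rfl fun t' _ => by ring

theorem slice_one [DecidableEq S] [DecidableEq T] (σ : Matrix T T ℂ) :
    slice (1 : Matrix (S × T) (S × T) ℂ) σ = σ.trace • 1 := by
  rw [← Matrix.one_kronecker_one, slice_kronecker, Matrix.one_mul]

theorem trace_slice_mul [Fintype S] (L : Matrix (S × T) (S × T) ℂ) (σ : Matrix T T ℂ)
    (w : Matrix S S ℂ) : (slice L σ * w).trace = (L * (w ⊗ₖ σ)).trace := by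
  simp only [slice, Matrix.trace, Matrix.diag, Matrix.mul_apply, Matrix.of_apply,
    Fintype.sum_prod_type, Matrix.kroneckerMap_apply, Finset.sum_mul]
  refine Finset.sum_congr rfl fun s _ => ?_
  rw [Finset.sum_comm]
  refine Finset.sum_congr rfl fun t _ => Finset.sum_congr rfl fun s' _ =>
    Finset.sum_congr rfl fun t' _ => by ring

end Positivity

/-! ### Cones of unnormalised measurement sets and compatible families -/

section Cones

theorem slice_submatrix_left {S S' T : Type*} [Fintype T] (f : S' → S)
    (L : Matrix (S × T) (S × T) ℂ) (σ : Matrix T T ℂ) :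
    slice (L.submatrix (Prod.map f id) (Prod.map f id)) σ = (slice L σ).submatrix f f := rfl

theorem slice_conj {S S' T : Type*} [Fintype S] [Fintype T] [DecidableEq T]
    (R : Matrix S' S ℂ) (L : Matrix (S × T) (S × T) ℂ) (σ : Matrix T T ℂ) :
    slice ((R ⊗ₖ (1 : Matrix T T ℂ)) * L * (R ⊗ₖ (1 : Matrix T T ℂ))ᴴ) σ =
      R * slice L σ * Rᴴ := by
  ext s s'
  simp only [slice, Matrix.mul_apply, Matrix.of_apply, Matrix.conjTranspose_apply,
    Matrix.kroneckerMap_apply, Fintype.sum_prod_type, Matrix.one_apply, mul_ite, mul_one, mul_zero,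
    ite_mul, zero_mul, Finset.sum_ite_eq, Finset.mem_univ, if_true, apply_ite star, star_zero]
  simp only [Finset.sum_mul, Finset.mul_sum]
  calc _ = ∑ t, ∑ s2, ∑ t', ∑ s1, R s s1 * L (s1, t) (s2, t') * star (R s' s2) * σ t' t :=
        Finset.sum_congr rfl fun t _ => Finset.sum_comm
    _ = ∑ s2, ∑ t, ∑ s1, ∑ t', R s s1 * L (s1, t) (s2, t') * star (R s' s2) * σ t' t := by
        rw [Finset.sum_comm]
        exact Finset.sum_congr rfl fun s2 _ => Finset.sum_congr rfl fun t _ => Finset.sum_comm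
    _ = ∑ s2, ∑ s1, ∑ t, ∑ t', R s s1 * L (s1, t) (s2, t') * star (R s' s2) * σ t' t :=
        Finset.sum_congr rfl fun s2 _ => Finset.sum_comm
    _ = _ := Finset.sum_congr rfl fun s2 _ => Finset.sum_congr rfl fun s1 _ =>
        Finset.sum_congr rfl fun t _ => Finset.sum_congr rfl fun t' _ => by ring

theorem partialTraceFst_mul_kronecker_one {V A : Type*} [Fintype V] [Fintype A] [DecidableEq A]
    (D : Matrix (V × A) (V × A) ℂ) (w : Matrix V V ℂ) :
    partialTraceFst (D * (w ⊗ₖ (1 : Matrix A A ℂ))) =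
      slice (D.submatrix Prod.swap Prod.swap) w := by
  ext i j
  simp [partialTraceFst, slice, Matrix.mul_apply, Fintype.sum_prod_type, Matrix.one_apply]

variable {V A B X O : Type*} [Fintype V] [DecidableEq V] [Fintype A] [Fintype B] [Fintype O]

/-- Unnormalised generalised measurement sets: `N a x = tr_V [D a (1 ⊗ ω x)]` for positive `D a`
with total `τ ⊗ 1`. -/
def GenCone (ω : X → Matrix V V ℂ) (N : O → X → Matrix A A ℂ) (τ : Matrix A A ℂ) : Prop :=
  ∃ D : O → Matrix (A × V) (A × V) ℂ, (∀ a, (D a).PosSemidef) ∧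
    ∑ a, D a = τ ⊗ₖ (1 : Matrix V V ℂ) ∧ ∀ a x, N a x = slice (D a) (ω x)

/-- Unnormalised compatible families, with parent operators of total `Z`. -/
def SepCone (ω : X → Matrix V V ℂ) (C : O → X → Matrix A A ℂ) (Z : Matrix A A ℂ) : Prop :=
  ∃ (k : ℕ) (G : Fin k → Matrix A A ℂ) (H : Fin k → O → Matrix V V ℂ),
    (∀ l, (G l).PosSemidef) ∧ ∑ l, G l = Z ∧ (∀ l, IsPOVM (H l)) ∧
    ∀ a x, C a x = ∑ l, (H l a * ω x).trace • G l

theorem isGenMeasSet_iff_genCone [DecidableEq A] {ω : X → Matrix V V ℂ}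
    {N : O → X → Matrix A A ℂ} : IsGenMeasSet ω N ↔ GenCone ω N 1 := by
  constructor
  · rintro ⟨L, ⟨hL, hL1⟩, hN⟩
    refine ⟨fun a => (L a).submatrix Prod.swap Prod.swap, fun a => (hL a).submatrix _, ?_,
      fun a x => by rw [hN, partialTraceFst_mul_kronecker_one]⟩
    rw [Matrix.one_kronecker_one, ← Matrix.submatrix_one_equiv (Equiv.prodComm A V), ← hL1]
    ext p q
    simp [Matrix.sum_apply]
  · rintro ⟨D, hD, hD1, hN⟩
    refine ⟨fun a => (D a).submatrix Prod.swap Prod.swap, ⟨fun a => (hD a).submatrix _, ?_⟩,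
      fun a x => by rw [hN, partialTraceFst_mul_kronecker_one]; rfl⟩
    rw [← Matrix.submatrix_one_equiv (Equiv.prodComm V A), ← Matrix.one_kronecker_one, ← hD1]
    ext p q
    simp [Matrix.sum_apply]

theorem isCompatible_iff_sepCone [DecidableEq A] {ω : X → Matrix V V ℂ}
    {C : O → X → Matrix A A ℂ} : IsCompatible ω C ↔ SepCone ω C 1 := by
  constructor
  · rintro ⟨k, G, H, ⟨h1, h2⟩, h3, h4⟩
    exact ⟨k, G, H, h1, h2, h3, h4⟩
  · rintro ⟨k, G, H, h1, h2, h3, h4⟩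
    exact ⟨k, G, H, ⟨h1, h2⟩, h3, h4⟩

namespace GenCone

variable {ω : X → Matrix V V ℂ} {N N' : O → X → Matrix A A ℂ} {τ τ' : Matrix A A ℂ}

theorem add (h : GenCone ω N τ) (h' : GenCone ω N' τ') : GenCone ω (N + N') (τ + τ') := by
  obtain ⟨D, h1, h2, h3⟩ := h
  obtain ⟨D', h1', h2', h3'⟩ := h'
  refine ⟨D + D', fun a => (h1 a).add (h1' a), ?_, fun a x => ?_⟩
  · rw [Matrix.add_kronecker, ← h2, ← h2', ← Finset.sum_add_distrib]; rfl
  · simp [slice_add, h3, h3']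

theorem smul (h : GenCone ω N τ) {c : ℝ} (hc : 0 ≤ c) :
    GenCone ω ((c : ℂ) • N) ((c : ℂ) • τ) := by
  obtain ⟨D, h1, h2, h3⟩ := h
  refine ⟨(c : ℂ) • D, fun a => (h1 a).ofReal_smul hc, ?_, fun a x => ?_⟩
  · rw [Matrix.smul_kronecker, ← h2, Finset.smul_sum]; rfl
  · rw [Pi.smul_apply, Pi.smul_apply, Pi.smul_apply, slice_smul, h3]

theorem conj (h : GenCone ω N τ) (R : Matrix B A ℂ) :
    GenCone ω (fun a x => R * N a x * Rᴴ) (R * τ * Rᴴ) := by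
  obtain ⟨D, h1, h2, h3⟩ := h
  refine ⟨fun a => (R ⊗ₖ (1 : Matrix V V ℂ)) * D a * (R ⊗ₖ (1 : Matrix V V ℂ))ᴴ,
    fun a => (h1 a).mul_mul_conjTranspose_same _, ?_, fun a x => ?_⟩
  · rw [← Matrix.sum_mul, ← Matrix.mul_sum, h2, Matrix.conjTranspose_kronecker,
      ← Matrix.mul_kronecker_mul, ← Matrix.mul_kronecker_mul]
    simp
  · simp only [h3, slice_conj]

theorem zero : GenCone ω (0 : O → X → Matrix A A ℂ) 0 :=
  ⟨0, fun _ => Matrix.PosSemidef.zero, by simp, fun a x => by ext; simp [slice]⟩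

theorem sum {ι : Type*} (u : Finset ι) {N : ι → O → X → Matrix A A ℂ} {τ : ι → Matrix A A ℂ}
    (h : ∀ i, GenCone ω (N i) (τ i)) : GenCone ω (∑ i ∈ u, N i) (∑ i ∈ u, τ i) := by
  classical
  induction u using Finset.induction_on with
  | empty => exact zero
  | insert i u hi ih => rw [Finset.sum_insert hi, Finset.sum_insert hi]; exact (h i).add ih

/-- Contracting τ ⊗ 1 with a trace-one input leaves τ. Totals can thus be read off from the family
at any single input. -/
theorem sum_apply (h : GenCone ω N τ) (hω : ∀ x, IsState (ω x)) (x : X) :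
    ∑ a, N a x = τ := by
  obtain ⟨D, h1, h2, h3⟩ := h
  simp only [h3]
  rw [← slice_sum, h2, slice_kronecker, Matrix.one_mul, (hω x).2, one_smul]

theorem posSemidef (h : GenCone ω N τ) (hω : ∀ x, IsState (ω x)) (a : O) (x : X) :
    (N a x).PosSemidef := by
  obtain ⟨D, h1, h2, h3⟩ := h
  rw [h3]
  exact slice_posSemidef (h1 a) (hω x).1

theorem total_posSemidef [Nonempty X] (h : GenCone ω N τ) (hω : ∀ x, IsState (ω x)) :
    τ.PosSemidef := by
  rw [← h.sum_apply hω (Classical.arbitrary X)]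
  exact Matrix.posSemidef_sum _ fun a _ => h.posSemidef hω a _

end GenCone

namespace SepCone

variable {ω : X → Matrix V V ℂ} {C C' : O → X → Matrix A A ℂ} {Z Z' : Matrix A A ℂ}

theorem of_fintype {ι : Type*} [Fintype ι] (G : ι → Matrix A A ℂ) (H : ι → O → Matrix V V ℂ)
    (hG : ∀ l, (G l).PosSemidef) (hH : ∀ l, IsPOVM (H l)) :
    SepCone ω (fun a x => ∑ l, (H l a * ω x).trace • G l) (∑ l, G l) := by
  let e := (Fintype.equivFin ι).symm
  exact ⟨Fintype.card ι, G ∘ e, H ∘ e, fun l => hG _, e.sum_comp G, fun l => hH _,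
    fun a x => (e.sum_comp fun l => (H l a * ω x).trace • G l).symm⟩

theorem single {G : Matrix A A ℂ} {H : O → Matrix V V ℂ} (hG : G.PosSemidef) (hH : IsPOVM H) :
    SepCone ω (fun a x => (H a * ω x).trace • G) G :=
  ⟨1, fun _ => G, fun _ => H, fun _ => hG, by simp, fun _ => hH, fun a x => by simp⟩

theorem add (h : SepCone ω C Z) (h' : SepCone ω C' Z') : SepCone ω (C + C') (Z + Z') := by
  obtain ⟨k, G, H, h1, h2, h3, h4⟩ := h
  obtain ⟨k', G', H', h1', h2', h3', h4'⟩ := h'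
  have := of_fintype (ω := ω) (Sum.elim G G') (Sum.elim H H') (by simpa using ⟨h1, h1'⟩)
    (by simpa using ⟨h3, h3'⟩)
  convert! this using 1
  · ext a x : 2
    simp [h4, h4']
  · simp [h2, h2']

theorem smul (h : SepCone ω C Z) {c : ℝ} (hc : 0 ≤ c) :
    SepCone ω ((c : ℂ) • C) ((c : ℂ) • Z) := by
  obtain ⟨k, G, H, h1, h2, h3, h4⟩ := h
  refine ⟨k, (c : ℂ) • G, H, fun l => (h1 l).ofReal_smul hc, ?_, h3, fun a x => ?_⟩
  · rw [← h2, Finset.smul_sum]; rfl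
  · simp [h4, Finset.smul_sum, smul_comm (c : ℂ)]

theorem conj (h : SepCone ω C Z) (R : Matrix B A ℂ) :
    SepCone ω (fun a x => R * C a x * Rᴴ) (R * Z * Rᴴ) := by
  obtain ⟨k, G, H, h1, h2, h3, h4⟩ := h
  refine ⟨k, fun l => R * G l * Rᴴ, H, fun l => (h1 l).mul_mul_conjTranspose_same _, ?_, h3,
    fun a x => ?_⟩
  · rw [← h2, Matrix.mul_sum, Matrix.sum_mul]
  · simp [h4, Matrix.mul_sum, Matrix.sum_mul]

theorem zero : SepCone ω (0 : O → X → Matrix A A ℂ) 0 :=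
  ⟨0, Fin.elim0, Fin.elim0, fun l => l.elim0, by simp, fun l => l.elim0, fun a x => by simp⟩

theorem sum {ι : Type*} (u : Finset ι) {C : ι → O → X → Matrix A A ℂ} {Z : ι → Matrix A A ℂ}
    (h : ∀ i, SepCone ω (C i) (Z i)) : SepCone ω (∑ i ∈ u, C i) (∑ i ∈ u, Z i) := by
  classical
  induction u using Finset.induction_on with
  | empty => exact zero
  | insert i u hi ih => rw [Finset.sum_insert hi, Finset.sum_insert hi]; exact (h i).add ih

/-- Measuring the parent and then the input is the separable joint measurement ∑ G_l ⊗ H_{a|l}. -/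
theorem genCone (h : SepCone ω C Z) : GenCone ω C Z := by
  obtain ⟨k, G, H, h1, h2, h3, h4⟩ := h
  refine ⟨fun a => ∑ l, G l ⊗ₖ H l a, fun a => Matrix.posSemidef_sum _ fun l _ =>
    (h1 l).kronecker ((h3 l).1 a), ?_, fun a x => ?_⟩
  · rw [Finset.sum_comm, ← h2]
    ext ⟨i, v⟩ ⟨j, w⟩
    simp only [Matrix.sum_apply, Matrix.kroneckerMap_apply, ← Finset.mul_sum, Finset.sum_mul]
    refine Finset.sum_congr rfl fun l _ => ?_
    rw [← (h3 l).2, Matrix.sum_apply]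
  · rw [h4, slice_sum]
    simp only [slice_kronecker]

theorem total_posSemidef (h : SepCone ω C Z) : Z.PosSemidef := by
  obtain ⟨k, G, H, h1, h2, h3, h4⟩ := h
  exact h2 ▸ Matrix.posSemidef_sum _ fun l _ => h1 l

theorem sum_apply (h : SepCone ω C Z) (hω : ∀ x, IsState (ω x)) (x : X) : ∑ a, C a x = Z :=
  h.genCone.sum_apply hω x

end SepCone

theorem isPOVM_uniform [Nonempty O] :
    IsPOVM fun _ : O => ((Fintype.card O : ℝ)⁻¹ : ℂ) • (1 : Matrix V V ℂ) := by
  refine ⟨fun _ => ?_, ?_⟩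
  · have := (Matrix.PosSemidef.one (n := V) (R := ℂ)).ofReal_smul
      (c := (Fintype.card O : ℝ)⁻¹) (by positivity)
    simpa using this
  · simp [← Nat.cast_smul_eq_nsmul ℂ, smul_smul]

/-- A uniformly random outcome ignores the input; its probability 1/|O| explains the factor |O| in
the total. Such families serve as padding. -/
theorem sepCone_const [Nonempty O] {ω : X → Matrix V V ℂ} (hω : ∀ x, IsState (ω x))
    {Q : Matrix A A ℂ} (hQ : Q.PosSemidef) :
    SepCone ω (fun (_ : O) _ => Q) (((Fintype.card O : ℝ) : ℂ) • Q) := by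
  have h := SepCone.single (ω := ω) (hQ.ofReal_smul (c := Fintype.card O) (by positivity))
    (isPOVM_uniform (V := V) (O := O))
  convert! h using 1
  ext a x : 2
  simp [(hω x).2, smul_smul]

end Cones

/-! ### Compactness of states, measurements and convex hulls -/

section Compactness

open Set

variable {n O : Type*} [Fintype n] [DecidableEq n] [Fintype O]

/-- The entries of a Gram matrix C†C are inner products of columns of C, whose squared norms add up
to the trace. -/
theorem Matrix.PosSemidef.norm_apply_le_trace {M : Matrix n n ℂ} (hM : M.PosSemidef) (i j : n) :
    ‖M i j‖ ≤ M.trace.re := by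
  obtain ⟨C, rfl⟩ := hM.exists_eq_conjTranspose_mul_self
  have htr : (Cᴴ * C).trace.re = ∑ i, ∑ k, ‖C k i‖ ^ 2 := by
    simp [Matrix.trace, Matrix.mul_apply, ← Complex.normSq_eq_norm_sq, Complex.normSq_apply]
  have hle (i : n) : ∑ k, ‖C k i‖ ^ 2 ≤ (Cᴴ * C).trace.re := by
    rw [htr]
    exact Finset.single_le_sum (f := fun i => ∑ k, ‖C k i‖ ^ 2)
      (fun i _ => Finset.sum_nonneg fun k _ => by positivity) (Finset.mem_univ i)
  calc ‖(Cᴴ * C) i j‖ ≤ ∑ k, ‖C k i‖ * ‖C k j‖ := by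
        rw [Matrix.mul_apply]
        refine (norm_sum_le _ _).trans (Finset.sum_le_sum fun k _ => ?_)
        simp
    _ ≤ ∑ k, (‖C k i‖ ^ 2 + ‖C k j‖ ^ 2) / 2 := Finset.sum_le_sum fun k _ => by
        nlinarith [sq_nonneg (‖C k i‖ - ‖C k j‖)]
    _ = (∑ k, ‖C k i‖ ^ 2 + ∑ k, ‖C k j‖ ^ 2) / 2 := by
        rw [← Finset.sum_div, Finset.sum_add_distrib]
    _ ≤ _ := by linarith [hle i, hle j]

theorem isClosed_setOf_posSemidef : IsClosed {M : Matrix n n ℂ | M.PosSemidef} := by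
  have : {M : Matrix n n ℂ | M.PosSemidef} =
      {M | Mᴴ = M} ∩ ⋂ x : n → ℂ, {M | 0 ≤ star x ⬝ᵥ (M *ᵥ x)} := by
    ext M
    simp [Matrix.posSemidef_iff_dotProduct_mulVec, Matrix.IsHermitian]
  rw [this]
  refine (isClosed_eq (by fun_prop) continuous_id).inter (isClosed_iInter fun x => ?_)
  exact isClosed_le continuous_const (by fun_prop)

theorem isCompact_setOf_posSemidef_trace_le (c : ℝ) :
    IsCompact {M : Matrix n n ℂ | M.PosSemidef ∧ M.trace.re ≤ c} := by
  have hK : IsCompact {M : Matrix n n ℂ | ∀ i, M i ∈ {v : n → ℂ | ∀ j, v j ∈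
      Metric.closedBall (0 : ℂ) c}} :=
    isCompact_pi_infinite fun i => isCompact_pi_infinite fun j => isCompact_closedBall _ _
  refine hK.of_isClosed_subset (isClosed_setOf_posSemidef.inter
    (isClosed_le (f := fun M : Matrix n n ℂ => M.trace.re) (by fun_prop) continuous_const))
    fun M hM i j => ?_
  simpa using (hM.1.norm_apply_le_trace i j).trans hM.2

theorem isCompact_setOf_isState : IsCompact {ρ : Matrix n n ℂ | IsState ρ} :=
  (isCompact_setOf_posSemidef_trace_le 1).of_isClosed_subset
    (isClosed_setOf_posSemidef.inter (isClosed_eq (by fun_prop) continuous_const))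
    fun M hM => ⟨hM.1, by simp [hM.2]⟩

theorem isCompact_setOf_isPOVM : IsCompact {L : O → Matrix n n ℂ | IsPOVM L} := by
  have hK : IsCompact {L : O → Matrix n n ℂ | ∀ a, L a ∈
      {M : Matrix n n ℂ | M.PosSemidef ∧ M.trace.re ≤ Fintype.card n}} :=
    isCompact_pi_infinite fun a => isCompact_setOf_posSemidef_trace_le _
  refine hK.of_isClosed_subset ?_ fun L hL a => ⟨hL.1 a, ?_⟩
  · refine IsClosed.inter (s₁ := {L : O → Matrix n n ℂ | ∀ a, (L a).PosSemidef})
      (s₂ := {L | ∑ a, L a = 1}) ?_ (isClosed_eq (by fun_prop) continuous_const)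
    simp only [ofPred_forall]
    exact isClosed_iInter fun a =>
      (isClosed_setOf_posSemidef (n := n)).preimage (f := fun L : O → Matrix n n ℂ => L a)
        (continuous_apply a)
  · have h : ∑ b, (L b).trace.re = Fintype.card n := by
      rw [← Complex.re_sum, ← Matrix.trace_sum, hL.2]
      simp
    rw [← h]
    exact Finset.single_le_sum (f := fun b => (L b).trace.re)
      (fun b _ => (hL.1 b).re_trace_nonneg) (Finset.mem_univ a)

theorem sum_extend_zero {ι κ F : Type*} [Fintype ι] [Fintype κ] [AddCommMonoid F] (e : ι ↪ κ)
    (g : ι → F) : ∑ i, Function.extend e g 0 i = ∑ j, g j := by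
  classical
  rw [← Finset.sum_subset (Finset.subset_univ (Finset.univ.map e)), Finset.sum_map]
  · exact Finset.sum_congr rfl fun j _ => e.injective.extend_apply _ _ _
  · intro i _ hi
    exact Function.extend_apply' _ _ _ fun ⟨j, hj⟩ => hi (by simp [← hj])

theorem IsCompact.convexHull_of_finiteDimensional {E : Type*} [AddCommGroup E] [Module ℝ E]
    [TopologicalSpace E] [IsTopologicalAddGroup E] [ContinuousSMul ℝ E] [FiniteDimensional ℝ E]
    {s : Set E} (hs : IsCompact s) : IsCompact (convexHull ℝ s) := by
  rcases s.eq_empty_or_nonempty with rfl | ⟨z₀, hz₀⟩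
  · simp
  let m := Module.finrank ℝ E + 1
  have hK : IsCompact (stdSimplex ℝ (Fin m) ×ˢ {z : Fin m → E | ∀ i, z i ∈ s}) :=
    (isCompact_stdSimplex ℝ _).prod (isCompact_pi_infinite fun _ => hs)
  have hf : Continuous fun p : (Fin m → ℝ) × (Fin m → E) => ∑ i, p.1 i • p.2 i := by fun_prop
  convert! hK.image hf using 1
  ext x
  constructor
  · intro hx
    obtain ⟨ι, _, z, w, hz, hind, hw, hw1, hx⟩ := eq_pos_convex_span_of_mem_convexHull hx
    -- Carathéodory: affinely independent points number at most dim + 1. Unused slots get weight 0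
    -- and the dummy point `z₀`, so the hull is the continuous image of a compact set.
    have hcard : Fintype.card ι ≤ Fintype.card (Fin m) := by
      simpa [m] using hind.card_le_finrank_succ.trans
        (Nat.succ_le_succ (Submodule.finrank_le _))
    obtain ⟨e⟩ := Function.Embedding.nonempty_of_card_le hcard
    refine ⟨(Function.extend e w 0, Function.extend e z fun _ => z₀), ⟨⟨fun i => ?_, ?_⟩,
      fun i => ?_⟩, ?_⟩
    · by_cases hi : ∃ j, e j = i
      · obtain ⟨j, rfl⟩ := hi
        simpa [e.injective.extend_apply] using (hw j).le
      · simp [Function.extend_apply' _ _ _ hi]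
    · exact (sum_extend_zero e w).trans hw1
    · by_cases hi : ∃ j, e j = i
      · obtain ⟨j, rfl⟩ := hi
        simpa [e.injective.extend_apply] using hz (mem_range_self j)
      · simpa [Function.extend_apply' _ _ _ hi] using hz₀
    · rw [← hx, ← sum_extend_zero e]
      refine Finset.sum_congr rfl fun i _ => ?_
      by_cases hi : ∃ j, e j = i
      · obtain ⟨j, rfl⟩ := hi
        simp [e.injective.extend_apply]
      · simp [Function.extend_apply' _ _ _ hi]
  · rintro ⟨⟨w, z⟩, ⟨hw, hz⟩, rfl⟩
    exact (convex_convexHull ℝ s).sum_mem (fun i _ => hw.1 i) hw.2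
      fun i _ => subset_convexHull ℝ s (hz i)

theorem Matrix.PosSemidef.exists_isState_smul {G ρ₀ : Matrix n n ℂ} (hG : G.PosSemidef)
    (hρ₀ : IsState ρ₀) : ∃ σ, IsState σ ∧ G = (G.trace.re : ℂ) • σ := by
  -- A positive operator of trace zero vanishes, so any state will do; `ρ₀` is the default.
  by_cases h : G.trace.re = 0
  · refine ⟨ρ₀, hρ₀, ?_⟩
    rw [h, Complex.ofReal_zero, zero_smul, ← hG.trace_eq_zero_iff, ← hG.ofReal_re_trace, h]
    simp
  · have h' : G.trace ≠ 0 := by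
      rw [← hG.ofReal_re_trace]; exact_mod_cast h
    refine ⟨((G.trace.re⁻¹ : ℝ) : ℂ) • G, ⟨hG.ofReal_smul (inv_nonneg.mpr hG.re_trace_nonneg), ?_⟩,
      ?_⟩
    · rw [Matrix.trace_smul, Complex.ofReal_inv, hG.ofReal_re_trace, smul_eq_mul,
        inv_mul_cancel₀ h']
    · rw [smul_smul, ← Complex.ofReal_mul, mul_inv_cancel₀ h, Complex.ofReal_one, one_smul]

theorem exists_isState [Nonempty n] : ∃ ρ : Matrix n n ℂ, IsState ρ := by
  obtain ⟨i⟩ := ‹Nonempty n›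
  refine ⟨Matrix.vecMulVec (Pi.single i 1) (star (Pi.single i 1)),
    Matrix.posSemidef_vecMulVec_self_star _, ?_⟩
  rw [Matrix.trace_vecMulVec]
  simp

end Compactness

/-! ### The robustness of incompatibility is attained -/

section Attainment

open Set

variable {V A X O : Type*} [Fintype V] [DecidableEq V] [Fintype A] [DecidableEq A] [Fintype O]

theorem isCompact_setOf_isGenMeasSet (ω : X → Matrix V V ℂ) :
    IsCompact {N : O → X → Matrix A A ℂ | IsGenMeasSet ω N} := by
  have hf : Continuous fun (L : O → Matrix (V × A) (V × A) ℂ) a x =>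
      partialTraceFst (L a * (ω x ⊗ₖ (1 : Matrix A A ℂ))) := by
    refine continuous_pi fun a => continuous_pi fun x => continuous_matrix fun i j => ?_
    simp only [partialTraceFst, Matrix.of_apply, Matrix.mul_apply]
    fun_prop
  convert! isCompact_setOf_isPOVM.image hf using 1
  ext N
  constructor
  · rintro ⟨L, hL, hN⟩
    exact ⟨L, hL, by ext a x : 2; exact (hN a x).symm⟩
  · rintro ⟨L, hL, rfl⟩
    exact ⟨L, hL, fun _ _ => rfl⟩

theorem convex_setOf_exists_sepCone (ω : X → Matrix V V ℂ) :
    Convex ℝ {C : O → X → Matrix A A ℂ | ∃ Z, SepCone ω C Z} := by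
  rintro C ⟨Z, h⟩ C' ⟨Z', h'⟩ s t hs ht -
  exact ⟨_, (h.smul hs).add (h'.smul ht)⟩

/-- The definition does not bound the number of parent outcomes. Normalising each parent operator to
a state exhibits a compatible family as d = tr 1 times a convex combination of families built from
one measurement and one state. Conversely, a point of the scaled hull is compatible once its total
is 1, a closed condition. -/
theorem isCompact_setOf_isCompatible [Nonempty A] [Finite X] [Nonempty X]
    {ω : X → Matrix V V ℂ} (hω : ∀ x, IsState (ω x)) :
    IsCompact {C : O → X → Matrix A A ℂ | IsCompatible ω C} := by
  have := Fintype.ofFinite X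
  let f : (O → Matrix V V ℂ) × Matrix A A ℂ → O → X → Matrix A A ℂ :=
    fun p a x => (p.1 a * ω x).trace • p.2
  have hf : Continuous f := by fun_prop
  let K := f '' ({H | IsPOVM H} ×ˢ {σ | IsState σ})
  have hK : IsCompact (convexHull ℝ K) :=
    ((isCompact_setOf_isPOVM.prod isCompact_setOf_isState).image hf).convexHull_of_finiteDimensional
  let d : ℝ := Fintype.card A
  have hd : d ≠ 0 := by simp [d]
  have hset : {C : O → X → Matrix A A ℂ | IsCompatible ω C} =
      (fun C => d • C) '' convexHull ℝ K ∩ {C | ∀ x, ∑ a, C a x = 1} := by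
    ext C
    constructor
    · intro hC
      refine ⟨⟨d⁻¹ • C, ?_, by simp [hd]⟩, fun x =>
        (isCompatible_iff_sepCone.mp hC).sum_apply hω x⟩
      obtain ⟨k, G, H, ⟨hG, hG1⟩, hH, hC⟩ := hC
      obtain ⟨ρ₀, hρ₀⟩ := exists_isState (n := A)
      choose σ hσ hGσ using fun l => (hG l).exists_isState_smul hρ₀
      have hsum : ∑ l, (G l).trace.re = d := by
        rw [← Complex.re_sum, ← Matrix.trace_sum, hG1]
        simp [d]
      have hCeq : d⁻¹ • C = ∑ l, (d⁻¹ * (G l).trace.re) • f (H l, σ l) := by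
        ext a x : 2
        simp only [Pi.smul_apply, Finset.sum_apply, hC, Finset.smul_sum, mul_smul]
        refine Finset.sum_congr rfl fun l _ => ?_
        conv_lhs => rw [hGσ l]
        simp only [f, Complex.coe_smul]
        rw [smul_comm (Matrix.trace _)]
      rw [hCeq]
      refine (convex_convexHull ℝ K).sum_mem (fun l _ => mul_nonneg (by positivity)
        (hG l).re_trace_nonneg) ?_ fun l _ => subset_convexHull ℝ K ⟨(H l, σ l), ⟨hH l, hσ l⟩, rfl⟩
      rw [← Finset.mul_sum, hsum, inv_mul_cancel₀ hd]
    · rintro ⟨⟨C, hC, rfl⟩, h1⟩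
      have hsub : convexHull ℝ K ⊆ {C | ∃ Z, SepCone ω C Z} := by
        refine convexHull_min ?_ (convex_setOf_exists_sepCone ω)
        rintro _ ⟨⟨H, σ⟩, ⟨hH, hσ⟩, rfl⟩
        exact ⟨σ, SepCone.single hσ.1 hH⟩
      obtain ⟨Z, hZ⟩ := hsub hC
      have h := hZ.smul (c := d) (by positivity)
      rw [← h.sum_apply hω (Classical.arbitrary X)] at h
      refine isCompatible_iff_sepCone.mpr ?_
      rw [← h1 (Classical.arbitrary X)]
      exact h
  rw [hset]
  refine (hK.image (continuous_const_smul d)).inter_right ?_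
  simp only [ofPred_forall]
  exact isClosed_iInter fun x => isClosed_eq (by fun_prop) continuous_const

theorem nonempty_outcomes {ω : X → Matrix V V ℂ} (hω : ∀ x, IsState (ω x)) [Nonempty A]
    [Nonempty X] {N : O → X → Matrix A A ℂ} (hN : IsGenMeasSet ω N) : Nonempty O := by
  by_contra hO
  rw [not_nonempty_iff] at hO
  have h := (isGenMeasSet_iff_genCone.mp hN).sum_apply hω (Classical.arbitrary X)
  have := congrFun (congrFun h (Classical.arbitrary A)) (Classical.arbitrary A)
  simp at this

/-- The difference equals KLK† + (1+η⁻¹) Q(1-L)Q with K = √η P - √η⁻¹ Q: the cross terms of KLK† are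
exactly -PLQ - QLP. -/
theorem Matrix.PosSemidef.pinching_sub {n : Type*} [Fintype n] [DecidableEq n]
    {L P Q : Matrix n n ℂ} (hL : L.PosSemidef) (hL1 : (1 - L).PosSemidef) (hPQ : P + Q = 1)
    (hP : P.IsHermitian) (hP2 : P * P = P) {η : ℝ} (hη : 0 < η) :
    (((1 + η : ℝ) : ℂ) • (P * L * P) + ((1 + η⁻¹ : ℝ) : ℂ) • Q - L).PosSemidef := by
  obtain rfl : Q = 1 - P := eq_sub_of_add_eq' hPQ
  have hQ : (1 - P).IsHermitian := Matrix.isHermitian_one.sub hP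
  have h1 := hL.mul_mul_conjTranspose_same (((√η : ℝ) : ℂ) • P - ((√η⁻¹ : ℝ) : ℂ) • (1 - P))
  have h2 := (hL1.mul_mul_conjTranspose_same (1 - P)).ofReal_smul (c := 1 + η⁻¹) (by positivity)
  have e1 : ((√η : ℝ) : ℂ) * ((√η : ℝ) : ℂ) = (η : ℂ) := by
    rw [← Complex.ofReal_mul, Real.mul_self_sqrt hη.le]
  have e2 : ((√η⁻¹ : ℝ) : ℂ) * ((√η⁻¹ : ℝ) : ℂ) = ((η⁻¹ : ℝ) : ℂ) := by
    rw [← Complex.ofReal_mul, Real.mul_self_sqrt (inv_nonneg.mpr hη.le)]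
  have e3 : ((√η : ℝ) : ℂ) * ((√η⁻¹ : ℝ) : ℂ) = 1 := by
    rw [← Complex.ofReal_mul, ← Real.sqrt_mul hη.le, mul_inv_cancel₀ hη.ne']
    simp
  have e4 : ((√η⁻¹ : ℝ) : ℂ) * ((√η : ℝ) : ℂ) = 1 := by rw [mul_comm, e3]
  convert! h1.add h2 using 1
  rw [hQ.eq, Matrix.conjTranspose_sub, Matrix.conjTranspose_smul, Matrix.conjTranspose_smul,
    hQ.eq, hP.eq]
  simp only [RCLike.star_def, Complex.conj_ofReal, sub_mul, mul_sub, Matrix.smul_mul,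
    Matrix.mul_smul, smul_sub, smul_smul, e1, e2, e3, e4, one_mul, mul_one, hP2,
    Complex.ofReal_add, Complex.ofReal_one, add_smul, one_smul]
  abel

theorem IsPOVM.one_sub_posSemidef {n : Type*} [Fintype n] [DecidableEq n]
    {L : O → Matrix n n ℂ} (hL : IsPOVM L) (a : O) : (1 - L a).PosSemidef := by
  classical
  rw [← hL.2, ← Finset.sum_erase_eq_sub (Finset.mem_univ a)]
  exact Matrix.posSemidef_sum _ fun b _ => hL.1 b

/-- Compressing with a projection `P` and padding on its complement dominates a generalised
measurement set. -/
theorem genCone_pinching_sub {ω : X → Matrix V V ℂ} {M : O → X → Matrix A A ℂ}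
    (hω : ∀ x, IsState (ω x)) (hM : GenCone ω M 1) {P Q : Matrix A A ℂ} (hPQ : P + Q = 1)
    (hP : P.IsHermitian) (hP2 : P * P = P) {η : ℝ} (hη : 0 < η) :
    GenCone ω (fun a x => ((1 + η : ℝ) : ℂ) • (P * M a x * P) + ((1 + η⁻¹ : ℝ) : ℂ) • Q - M a x)
      (((1 + η : ℝ) : ℂ) • P + (((1 + η⁻¹ : ℝ) : ℂ) * (Fintype.card O : ℝ)) • Q - 1) := by
  obtain ⟨L, hL, hL1, hM⟩ := hM
  have hPOVM : IsPOVM L := ⟨hL, by rw [hL1, Matrix.one_kronecker_one]⟩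
  have hP' : (P ⊗ₖ (1 : Matrix V V ℂ)).IsHermitian := by
    rw [Matrix.IsHermitian, Matrix.conjTranspose_kronecker, hP.eq, Matrix.conjTranspose_one]
  have hPP : (P ⊗ₖ (1 : Matrix V V ℂ)) * (P ⊗ₖ (1 : Matrix V V ℂ)) = P ⊗ₖ (1 : Matrix V V ℂ) := by
    rw [← Matrix.mul_kronecker_mul, hP2, Matrix.one_mul]
  refine ⟨fun a => ((1 + η : ℝ) : ℂ) • ((P ⊗ₖ (1 : Matrix V V ℂ)) * L a * (P ⊗ₖ (1 : Matrix V V ℂ)))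
    + ((1 + η⁻¹ : ℝ) : ℂ) • (Q ⊗ₖ (1 : Matrix V V ℂ)) - L a,
    fun a => (hL a).pinching_sub (hPOVM.one_sub_posSemidef a)
      (by rw [← Matrix.add_kronecker, hPQ, Matrix.one_kronecker_one]) hP' hPP hη, ?_, fun a x => ?_⟩
  · rw [Finset.sum_sub_distrib, Finset.sum_add_distrib, ← Finset.smul_sum, ← Matrix.sum_mul,
      ← Matrix.mul_sum, hL1, Matrix.one_kronecker_one, Matrix.mul_one, hPP]
    rw [Finset.sum_const, Finset.card_univ, ← Nat.cast_smul_eq_nsmul ℂ,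
      ← Matrix.one_kronecker_one]
    ext i j
    simp only [Matrix.sub_apply, Matrix.add_apply, Matrix.smul_apply, Matrix.kroneckerMap_apply,
      smul_eq_mul, Complex.ofReal_natCast]
    ring
  · beta_reduce
    have h := slice_conj P (L a) (ω x)
    rw [hP'.eq, hP.eq] at h
    rw [sub_eq_add_neg, sub_eq_add_neg, ← neg_one_smul ℂ (L a), slice_add, slice_add, slice_smul,
      slice_smul, slice_smul, slice_kronecker, h, hM, Matrix.one_mul, (hω x).2, one_smul,
      neg_one_smul]

/-- Here N already carries the weight r, so r must be nonzero to recover a normalised noise family.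
-/
theorem mem_incompatibilityFeasible {ω : X → Matrix V V ℂ} {M N : O → X → Matrix A A ℂ} {r : ℝ}
    (hr : 0 < r) (hN : GenCone ω N ((r : ℂ) • 1))
    (hC : SepCone ω (fun a x => M a x + N a x) (((1 + r : ℝ) : ℂ) • 1)) :
    r ∈ incompatibilityFeasible ω M := by
  have hr0 : (r : ℂ) ≠ 0 := by exact_mod_cast hr.ne'
  have hr1 : ((1 + r : ℝ) : ℂ) ≠ 0 := by exact_mod_cast (by linarith : (1 + r : ℝ) ≠ 0)
  refine ⟨hr.le, ((r⁻¹ : ℝ) : ℂ) • N, ?_, ?_⟩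
  · have h := hN.smul (inv_nonneg.mpr hr.le)
    rw [Complex.ofReal_inv, inv_smul_smul₀ hr0, ← Complex.ofReal_inv] at h
    exact isGenMeasSet_iff_genCone.mpr h
  · have h := hC.smul (c := (1 + r)⁻¹) (by positivity)
    rw [Complex.ofReal_inv, inv_smul_smul₀ hr1] at h
    refine isCompatible_iff_sepCone.mpr ?_
    convert! h using 1
    ext a x : 2
    simp only [Pi.smul_apply, Complex.ofReal_inv, smul_inv_smul₀ hr0]

theorem incompatibilityFeasible_nonempty [Nonempty O] {ω : X → Matrix V V ℂ}
    (hω : ∀ x, IsState (ω x)) {M : O → X → Matrix A A ℂ} (hM : IsGenMeasSet ω M) :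
    (incompatibilityFeasible ω M).Nonempty := by
  let d : ℝ := Fintype.card O
  have hd : 1 ≤ d := by
    simp [d, Nat.one_le_iff_ne_zero]
  -- With P = 0 and η = 1 the pinching bound says that 2·1 - M is an unnormalised measurement set,
  -- of total 2|O| - 1.
  have hN := genCone_pinching_sub hω (isGenMeasSet_iff_genCone.mp hM) (P := 0) (Q := 1) (by simp)
    Matrix.isHermitian_zero (by simp) one_pos
  have hC := (sepCone_const (O := O) hω (Matrix.PosSemidef.one (n := A) (R := ℂ))).smul
    (c := 2) zero_le_two
  refine ⟨2 * d - 1, mem_incompatibilityFeasible (by linarith) (N := fun a x => 2 - M a x) ?_ ?_⟩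
  · convert! hN using 1
    · ext a x : 2
      simp [← one_add_one_eq_two, add_smul]
    · simp [d, sub_smul, ← one_add_one_eq_two, mul_comm]
  · convert! hC using 1
    · ext a x : 2
      simp [← one_add_one_eq_two, add_smul]
    · simp [d, smul_smul]

theorem isLeast_robustnessI [Nonempty A] [Finite X] [Nonempty X] {ω : X → Matrix V V ℂ}
    (hω : ∀ x, IsState (ω x)) {M : O → X → Matrix A A ℂ} (hM : IsGenMeasSet ω M) :
    IsLeast (incompatibilityFeasible ω M) (robustnessI ω M) := by
  have := nonempty_outcomes hω hM
  obtain ⟨r₀, hr₀⟩ := incompatibilityFeasible_nonempty hω hM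
  let S := incompatibilityFeasible ω M ∩ Icc 0 r₀
  have hS : IsCompact S := by
    have hK := (isCompact_Icc (a := (0 : ℝ)) (b := r₀)).prod
      ((isCompact_setOf_isGenMeasSet (O := O) (A := A) ω).prod
        (isCompact_setOf_isCompatible (O := O) (A := A) hω))
    -- With denominators cleared the mixing relation is closed; the feasible r up to `r₀` are the
    -- projection of a compact set of triples.
    have hcl : IsClosed {p : ℝ × (O → X → Matrix A A ℂ) × (O → X → Matrix A A ℂ) |
        M + (p.1 : ℂ) • p.2.1 = ((1 + p.1 : ℝ) : ℂ) • p.2.2} :=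
      isClosed_eq (by fun_prop) (by fun_prop)
    convert! (hK.inter_right hcl).image continuous_fst using 1
    ext r
    constructor
    · rintro ⟨⟨h0, N, hN, hC⟩, hr⟩
      refine ⟨(r, N, _), ⟨⟨hr, hN, hC⟩, ?_⟩, rfl⟩
      have h1 : ((1 + r : ℝ) : ℂ) ≠ 0 := by exact_mod_cast (by linarith : (1 + r : ℝ) ≠ 0)
      ext a x : 2
      change _ = ((1 + r : ℝ) : ℂ) • (((1 + r : ℝ) : ℂ)⁻¹ • (M a x + (r : ℂ) • N a x))
      rw [smul_inv_smul₀ h1]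
      rfl
    · rintro ⟨⟨r, N, C⟩, ⟨⟨hr, hN, hC⟩, h⟩, rfl⟩
      refine ⟨⟨hr.1, N, hN, ?_⟩, hr⟩
      have h1 : ((1 + r : ℝ) : ℂ) ≠ 0 := by
        have := hr.1
        exact_mod_cast (by linarith : (1 + r : ℝ) ≠ 0)
      convert! hC using 1
      ext a x : 2
      have := congrFun (congrFun h a) x
      change M a x + (r : ℂ) • N a x = ((1 + r : ℝ) : ℂ) • C a x at this
      change ((1 + r : ℝ) : ℂ)⁻¹ • (M a x + (r : ℂ) • N a x) = C a x
      rw [this, inv_smul_smul₀ h1]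
  obtain ⟨r, hr, hmin⟩ := hS.exists_isLeast ⟨r₀, hr₀, hr₀.1, le_rfl⟩
  have hleast : IsLeast (incompatibilityFeasible ω M) r := by
    refine ⟨hr.1, fun t ht => ?_⟩
    rcases le_total t r₀ with h | h
    · exact hmin ⟨ht, ht.1, h⟩
    · exact hr.2.2.trans h
  rw [robustnessI, hleast.csInf_eq]
  exact hleast

end Attainment

/-! ### An optimal state by minimax -/

section Minimax

open Set

theorem Matrix.posSemidef_of_forall_isState {n : Type*} [Fintype n]
    {W : Matrix n n ℂ} (hW : W.IsHermitian)
    (h : ∀ ρ, IsState ρ → 0 ≤ (W * ρ).trace.re) : W.PosSemidef := by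
  refine Matrix.PosSemidef.of_dotProduct_mulVec_nonneg hW fun x => ?_
  have : Nonempty n ∨ IsEmpty n := (isEmpty_or_nonempty n).symm
  rcases this with hn | hn
  · classical
    obtain ⟨ρ₀, hρ₀⟩ := exists_isState (n := n)
    have hG := Matrix.posSemidef_vecMulVec_self_star x
    obtain ⟨σ, hσ, hGσ⟩ := hG.exists_isState_smul hρ₀
    have hre : (star x ⬝ᵥ W *ᵥ x).re = (W * Matrix.vecMulVec x (star x)).trace.re := by
      rw [Matrix.mul_vecMulVec, Matrix.trace_vecMulVec, dotProduct_comm]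
    have him : (star x ⬝ᵥ W *ᵥ x).im = 0 := hW.im_star_dotProduct_mulVec_self x
    refine Complex.nonneg_iff.mpr ⟨?_, him.symm⟩
    rw [hre, hGσ, Matrix.mul_smul, Matrix.trace_smul, smul_eq_mul, Complex.re_ofReal_mul]
    exact mul_nonneg hG.re_trace_nonneg (h σ hσ)
  · simp [dotProduct]

variable {V A X O : Type*} [Fintype V] [DecidableEq V] [Fintype A] [DecidableEq A] [Fintype O]

/-- The totals `Z` of the unnormalised compatible families dominating `M`. -/
def dominatingTotals (ω : X → Matrix V V ℂ) (M : O → X → Matrix A A ℂ) : Set (Matrix A A ℂ) :=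
  {Z | ∃ N τ, GenCone ω N τ ∧ SepCone ω (fun a x => M a x + N a x) Z}

theorem convex_dominatingTotals (ω : X → Matrix V V ℂ) (M : O → X → Matrix A A ℂ) :
    Convex ℝ (dominatingTotals ω M) := by
  rintro Z ⟨N, τ, h1, h2⟩ Z' ⟨N', τ', h1', h2'⟩ s t hs ht hst
  refine ⟨_, _, (h1.smul hs).add (h1'.smul ht), ?_⟩
  convert! (h2.smul hs).add (h2'.smul ht) using 1
  ext a x : 2
  have : M a x = ((s : ℝ) : ℂ) • M a x + ((t : ℝ) : ℂ) • M a x := by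
    rw [← add_smul, ← Complex.ofReal_add, hst, Complex.ofReal_one, one_smul]
  conv_lhs => rw [this]
  simp only [Pi.add_apply, Pi.smul_apply, smul_add]
  abel

/-- Adding the constant family P/|O|, which is compatible with total P, to both sides shows that
totals may be increased. -/
theorem SepCone.mem_dominatingTotals_add [Nonempty O] {ω : X → Matrix V V ℂ}
    (hω : ∀ x, IsState (ω x)) {M N : O → X → Matrix A A ℂ} {τ Z P : Matrix A A ℂ}
    (hN : GenCone ω N τ) (hC : SepCone ω (fun a x => M a x + N a x) Z) (hP : P.PosSemidef) :
    ∃ N', GenCone ω N' (τ + P) ∧ SepCone ω (fun a x => M a x + N' a x) (Z + P) := by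
  have h := sepCone_const (O := O) hω (hP.ofReal_smul (c := (Fintype.card O : ℝ)⁻¹) (by positivity))
  rw [smul_smul, ← Complex.ofReal_mul, mul_inv_cancel₀ (by simp), Complex.ofReal_one, one_smul] at h
  refine ⟨_, hN.add h.genCone, ?_⟩
  convert! hC.add h using 1
  ext a x : 2
  simp [add_assoc]

/-- Otherwise every state is beaten by some total, finitely many totals suffice by compactness, and
Sion's theorem merges them into one Z with tr(Zρ) < 1 + R_I for all states. Padding Z to a multiple
of 1 then yields a feasible weight below R_I. -/
theorem exists_isState_le_trace_dominatingTotals [Nonempty A] [Finite X] [Nonempty X]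
    {ω : X → Matrix V V ℂ} (hω : ∀ x, IsState (ω x)) {M : O → X → Matrix A A ℂ}
    (hM : IsGenMeasSet ω M) :
    ∃ ρ, IsState ρ ∧ ∀ Z ∈ dominatingTotals ω M, 1 + robustnessI ω M ≤ (Z * ρ).trace.re := by
  have := nonempty_outcomes hω hM
  by_contra! hcon
  set t₀ := 1 + robustnessI ω M with ht₀
  have hK := isCompact_setOf_isState (n := A)
  obtain ⟨u, hu⟩ := hK.elim_finite_subcover
    (fun Z : dominatingTotals ω M => {ρ | (Z.1 * ρ).trace.re < t₀})
    (fun Z => isOpen_lt (by fun_prop) continuous_const) fun ρ hρ => by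
      obtain ⟨Z, hZ, h⟩ := hcon ρ hρ
      exact mem_iUnion.mpr ⟨⟨Z, hZ⟩, h⟩
  have hconv : Convex ℝ {ρ : Matrix A A ℂ | IsState ρ} := by
    intro ρ hρ σ hσ s t hs ht hst
    refine ⟨(hρ.1.ofReal_smul hs).add (hσ.1.ofReal_smul ht), ?_⟩
    rw [Matrix.trace_add, Matrix.trace_smul, Matrix.trace_smul, hρ.2, hσ.2]
    simp [← Complex.ofReal_add, hst]
  have hlin₁ (Z : Matrix A A ℂ) : IsLinearMap ℝ fun ρ => -(Z * ρ).trace.re :=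
    ⟨fun x y => by simp [mul_add]; ring, fun c x => by simp⟩
  have hlin₂ (ρ : Matrix A A ℂ) : IsLinearMap ℝ fun Z => -(Z * ρ).trace.re :=
    ⟨fun x y => by simp [add_mul]; ring, fun c x => by simp⟩
  obtain ⟨Z, hZ, hlt⟩ := Sion.exists_lt_iInf_of_lt_iInf_of_finite
    (X := {ρ : Matrix A A ℂ | IsState ρ}) (Y := dominatingTotals ω M)
    (f := fun ρ Z => -(Z * ρ).trace.re) exists_isState hK
    (fun Z _ => (Continuous.lowerSemicontinuous (by fun_prop)).lowerSemicontinuousOn _)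
    (fun Z _ => ((hlin₁ Z).mk' _).convexOn hconv |>.quasiconvexOn)
    (convex_dominatingTotals ω M)
    (fun ρ _ => (Continuous.upperSemicontinuous (by fun_prop)).upperSemicontinuousOn _)
    (fun ρ _ => ((hlin₂ ρ).mk' _).concaveOn (convex_dominatingTotals ω M) |>.quasiconcaveOn)
    hconv (s := Subtype.val '' (u : Set (dominatingTotals ω M))) (u.finite_toSet.image _)
    (by rintro _ ⟨Z, -, rfl⟩; exact Z.2) (t := -t₀) fun ρ hρ => by
      obtain ⟨Z, hZ, h⟩ := mem_iUnion₂.mp (hu hρ)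
      exact ⟨Z.1, ⟨Z, hZ, rfl⟩, neg_lt_neg h⟩
  obtain ⟨ρ, hρ, hmax⟩ := hK.exists_isMaxOn exists_isState
    (f := fun ρ => (Z * ρ).trace.re) (by fun_prop)
  set t := (Z * ρ).trace.re with ht
  have htt : t < t₀ := neg_lt_neg_iff.mp (hlt ρ hρ)
  obtain ⟨N, τ, hN, hC⟩ := hZ
  have hZτ : Z = 1 + τ := by
    let x := Classical.arbitrary X
    rw [← hC.sum_apply hω x, ← hN.sum_apply hω x, Finset.sum_add_distrib,
      (isGenMeasSet_iff_genCone.mp hM).sum_apply hω x]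
  have ht1 : 1 ≤ t := by
    rw [ht, hZτ, add_mul, one_mul, Matrix.trace_add, hρ.2, Complex.add_re, Complex.one_re]
    linarith [(hN.total_posSemidef hω).re_trace_mul_nonneg hρ.1]
  -- The midpoint is below `t₀` and strictly above `t ≥ 1`, so the weight t' - 1 is positive even if
  -- t = 1.
  set t' := (t + t₀) / 2 with ht'
  have hP : ((t' : ℂ) • 1 - Z).PosSemidef := by
    refine Matrix.posSemidef_of_forall_isState
      (((Matrix.PosSemidef.one.ofReal_smul (by linarith)).isHermitian).sub
        hC.total_posSemidef.isHermitian) fun σ hσ => ?_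
    have := hmax hσ
    simp only [mem_ofPred_eq] at this
    rw [sub_mul, Matrix.trace_sub, Matrix.smul_mul, Matrix.one_mul, Matrix.trace_smul, hσ.2]
    simp
    linarith
  obtain ⟨N', hN', hC'⟩ := SepCone.mem_dominatingTotals_add hω hN hC hP
  rw [add_sub_cancel] at hC'
  have hτ : τ + ((t' : ℂ) • 1 - Z) = ((t' - 1 : ℝ) : ℂ) • 1 := by
    rw [hZτ, Complex.ofReal_sub, Complex.ofReal_one, sub_smul, one_smul]
    abel
  have hmem : t' - 1 ∈ incompatibilityFeasible ω M := by
    refine mem_incompatibilityFeasible (by linarith) (hτ ▸ hN') ?_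
    rw [add_sub_cancel]
    exact hC'
  have hle : robustnessI ω M ≤ t' - 1 := (isLeast_robustnessI hω hM).2 hmem
  linarith

end Minimax

/-! ### Nonlocality is bounded by incompatibility -/

section UpperBound

theorem Matrix.trace_submatrix_self_equiv {m n : Type*} [Fintype m] [Fintype n] (e : m ≃ n)
    (M : Matrix n n ℂ) : (M.submatrix e e).trace = M.trace :=
  e.sum_comp fun i => M i i

section Slice

variable {S T : Type*} [Fintype S] [Fintype T]

theorem trace_kronecker_mul (P : Matrix S S ℂ) (Q : Matrix T T ℂ)
    (ρ : Matrix (S × T) (S × T) ℂ) : ((P ⊗ₖ Q) * ρ).trace = (slice ρ Q * P).trace := by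
  rw [trace_slice_mul, Matrix.trace_mul_comm]

theorem trace_slice_mul_swap (L : Matrix (S × T) (S × T) ℂ) (σ : Matrix T T ℂ)
    (w : Matrix S S ℂ) :
    (slice (L.submatrix Prod.swap Prod.swap) w * σ).trace = (slice L σ * w).trace := by
  rw [trace_slice_mul, trace_slice_mul, ← Matrix.trace_submatrix_self_equiv (Equiv.prodComm T S),
    ← Matrix.submatrix_mul_equiv _ _ _ (Equiv.prodComm T S)]
  congr 2
  ext i j
  simp [mul_comm]

end Slice

variable {V A X O : Type*} [Fintype V] [DecidableEq V] [Fintype A] [DecidableEq A] [Fintype O]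
variable {W B Y P : Type*} [Fintype W] [DecidableEq W] [Fintype B] [DecidableEq B] [Fintype P]

theorem GenCone.submatrix {ω : X → Matrix V V ℂ} {N : O → X → Matrix A A ℂ} {τ : Matrix A A ℂ}
    (h : GenCone ω N τ) (f : B → A) :
    GenCone ω (fun a x => (N a x).submatrix f f) (τ.submatrix f f) := by
  obtain ⟨D, h1, h2, h3⟩ := h
  refine ⟨fun a => (D a).submatrix (Prod.map f id) (Prod.map f id), fun a => (h1 a).submatrix _,
    ?_, fun a x => by simp only [slice_submatrix_left, h3]⟩
  ext i j
  have := congrFun (congrFun h2 (Prod.map f id i)) (Prod.map f id j)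
  rw [Matrix.sum_apply] at this ⊢
  exact this

theorem IsGenMeasSet.submatrix {ω : X → Matrix V V ℂ} {N : O → X → Matrix A A ℂ}
    (h : IsGenMeasSet ω N) (e : B ≃ A) :
    IsGenMeasSet ω fun a x => (N a x).submatrix e e := by
  have := (isGenMeasSet_iff_genCone.mp h).submatrix e
  rw [Matrix.submatrix_one_equiv] at this
  exact isGenMeasSet_iff_genCone.mpr this

theorem IsState.submatrix {ρ : Matrix A A ℂ} (h : IsState ρ) (e : B ≃ A) :
    IsState (ρ.submatrix e e) :=
  ⟨h.1.submatrix _, by rw [Matrix.trace_submatrix_self_equiv, h.2]⟩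

theorem isBuscemiBehaviour_behaviour {ω : X → Matrix V V ℂ} {ζ : Y → Matrix W W ℂ}
    {NA : O → X → Matrix A A ℂ} {NB : P → Y → Matrix B B ℂ} {σ : Matrix (A × B) (A × B) ℂ}
    (hA : IsGenMeasSet ω NA) (hB : IsGenMeasSet ζ NB) (hσ : IsState σ) :
    IsBuscemiBehaviour ω ζ (behaviour NA NB σ) := by
  let e := (Fintype.equivFin A).symm
  let f := (Fintype.equivFin B).symm
  refine ⟨_, _, _, _, _, hA.submatrix e, hB.submatrix f, hσ.submatrix (e.prodCongr f), ?_⟩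
  ext a b x y
  rw [behaviour, behaviour, ← Matrix.trace_submatrix_self_equiv (e.prodCongr f),
    ← Matrix.submatrix_mul_equiv _ _ _ (e.prodCongr f)]
  rfl

/-- Measuring one half of a state with a generalised measurement set amounts to measuring the
quantum input. -/
theorem IsGenMeasSet.exists_isPOVM_trace {ζ : Y → Matrix W W ℂ} {N : P → Y → Matrix B B ℂ}
    (h : IsGenMeasSet ζ N) {σ : Matrix B B ℂ} (hσ : IsState σ) :
    ∃ K : P → Matrix W W ℂ, IsPOVM K ∧ ∀ b y, (N b y * σ).trace = (K b * ζ y).trace := by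
  obtain ⟨D, h1, h2, h3⟩ := isGenMeasSet_iff_genCone.mp h
  refine ⟨fun b => slice ((D b).submatrix Prod.swap Prod.swap) σ,
    ⟨fun b => slice_posSemidef ((h1 b).submatrix _) hσ.1, ?_⟩, fun b y => ?_⟩
  · rw [← slice_sum]
    have : ∑ b, (D b).submatrix Prod.swap Prod.swap = (1 : Matrix (W × B) (W × B) ℂ) := by
      rw [← Matrix.submatrix_one_equiv (Equiv.prodComm W B), ← Matrix.one_kronecker_one, ← h2]
      ext i j
      simp [Matrix.sum_apply]
    rw [this, slice_one, hσ.2, one_smul]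
  · rw [h3, trace_slice_mul_swap]

theorem incompatibilityFeasible_subset_nonlocalityFeasible [Nonempty A] {ω : X → Matrix V V ℂ}
    (hω : ∀ x, IsState (ω x)) (M : O → X → Matrix A A ℂ)
    {ζ : Y → Matrix W W ℂ} (hζ : ∀ y, IsState (ζ y)) {MB : P → Y → Matrix B B ℂ}
    (hMB : IsGenMeasSet ζ MB) {ρ : Matrix (A × B) (A × B) ℂ} (hρ : IsState ρ) :
    incompatibilityFeasible ω M ⊆ nonlocalityFeasible ω ζ (behaviour M MB ρ) := by
  rintro r ⟨hr, N, hN, k, G, H, ⟨hG, hG1⟩, hH, hC⟩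
  refine ⟨hr, _, isBuscemiBehaviour_behaviour hN hMB hρ, ?_⟩
  -- The unnormalised state of Bob conditioned on an effect of Alice. Its trace at G_l is the weight
  -- q(l); Bob's reduced state `ρB 1` is the default when that weight is zero.
  let ρB : Matrix A A ℂ → Matrix B B ℂ := slice (ρ.submatrix Prod.swap Prod.swap)
  have hρB (l) : (ρB (G l)).PosSemidef := slice_posSemidef (hρ.1.submatrix _) (hG l)
  have htr (Q : Matrix A A ℂ) : (ρB Q).trace = (slice ρ 1 * Q).trace := by
    rw [← trace_slice_mul_swap, Matrix.mul_one]
  have htot : (slice ρ (1 : Matrix B B ℂ)).trace = 1 := by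
    have := trace_slice_mul ρ (1 : Matrix B B ℂ) (1 : Matrix A A ℂ)
    rwa [Matrix.mul_one, Matrix.one_kronecker_one, Matrix.mul_one, hρ.2] at this
  have h1 : IsState (ρB 1) :=
    ⟨slice_posSemidef (hρ.1.submatrix _) Matrix.PosSemidef.one, by rw [htr, Matrix.mul_one, htot]⟩
  choose σ hσ hGσ using fun l => (hρB l).exists_isState_smul h1
  choose K hK hKσ using fun l => hMB.exists_isPOVM_trace (hσ l)
  refine ⟨k, fun l => (ρB (G l)).trace.re, H, K, ⟨fun l => (hρB l).re_trace_nonneg, ?_⟩, hH, hK,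
    fun a b x y => ?_⟩
  · rw [← Complex.re_sum]
    simp only [htr]
    rw [← Matrix.trace_sum, ← Matrix.mul_sum, hG1, Matrix.mul_one, htot, Complex.one_re]
  · have hlin : (behaviour M MB ρ a b x y + r * behaviour N MB ρ a b x y) / (1 + r) =
        (slice ρ (MB b y) * (((1 + r : ℝ) : ℂ)⁻¹ • (M a x + (r : ℂ) • N a x))).trace.re := by
      rw [behaviour, behaviour, trace_kronecker_mul, trace_kronecker_mul, Matrix.mul_smul,
        Matrix.trace_smul, Matrix.mul_add, Matrix.trace_add, Matrix.mul_smul, Matrix.trace_smul,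
        ← Complex.ofReal_inv, smul_eq_mul, Complex.re_ofReal_mul, Complex.add_re, smul_eq_mul,
        Complex.re_ofReal_mul, div_eq_inv_mul]
    beta_reduce at hC ⊢
    rw [hlin, hC, Matrix.mul_sum, Matrix.trace_sum, Complex.re_sum]
    refine Finset.sum_congr rfl fun l _ => ?_
    have hl : (slice ρ (MB b y) * G l).trace =
        ((ρB (G l)).trace.re : ℂ) * ((K l b * ζ y).trace.re : ℂ) := by
      rw [((hK l).1 b).ofReal_re_trace_mul (hζ y).1, ← hKσ, ← trace_slice_mul_swap,
        Matrix.trace_mul_comm]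
      change (MB b y * ρB (G l)).trace = _
      conv_lhs => rw [hGσ l]
      rw [Matrix.mul_smul, Matrix.trace_smul, smul_eq_mul]
    rw [Matrix.mul_smul, Matrix.trace_smul, hl, ← ((hH l).1 a).ofReal_re_trace_mul (hω x).1,
      smul_eq_mul, ← Complex.ofReal_mul, ← Complex.ofReal_mul, Complex.ofReal_re,
      Complex.ofReal_re]
    ring

end UpperBound

/-! ### Purification, Weyl operators and tomography -/

section LowerBound

/-- Up to the relabelling `e` of columns, s is √ρ, T its pseudo-inverse and P the support
projection, all functions of ρ in one eigenbasis. The convention 0⁻¹ = 0 supplies the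
pseudo-inverse, and T†ρT is a relabelled P. -/
theorem Matrix.PosSemidef.exists_support_factorization {A B : Type*} [Fintype A] [DecidableEq A]
    [Fintype B] [DecidableEq B] {ρ : Matrix A A ℂ} (hρ : ρ.PosSemidef) (e : B ≃ A) :
    ∃ (s T : Matrix A B ℂ) (P : Matrix A A ℂ), s * sᴴ = ρ ∧ T * sᴴ = P ∧ P.IsHermitian ∧
      P * P = P ∧ P * ρ = ρ ∧ (1 - Tᴴ * ρ * T).PosSemidef := by
  let U : Matrix A A ℂ := hρ.isHermitian.eigenvectorUnitary
  have hU : Uᴴ * U = 1 := Unitary.coe_star_mul_self hρ.isHermitian.eigenvectorUnitary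
  let l := hρ.isHermitian.eigenvalues
  have hl (i) : 0 ≤ l i := hρ.eigenvalues_nonneg i
  let E (f : A → ℝ) : Matrix A A ℂ := U * Matrix.diagonal (fun i => (f i : ℂ)) * Uᴴ
  have hE (f g) : E f * E g = E fun i => f i * g i := by
    calc E f * E g = U * Matrix.diagonal (fun i => (f i : ℂ)) * (Uᴴ * U) *
          Matrix.diagonal (fun i => (g i : ℂ)) * Uᴴ := by simp only [E, Matrix.mul_assoc]
      _ = _ := by
        rw [hU, Matrix.mul_one, Matrix.mul_assoc U, Matrix.diagonal_mul_diagonal]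
        simp [E]
  have hEH (f) : (E f)ᴴ = E f := by
    simp only [E, Matrix.conjTranspose_mul, Matrix.conjTranspose_conjTranspose,
      Matrix.diagonal_conjTranspose, ← Matrix.mul_assoc]
    congr 3
    ext i
    simp
  have hρE : ρ = E l := hρ.isHermitian.spectral_theorem
  let s := E fun i => √(l i)
  let T := E fun i => (√(l i))⁻¹
  let P := E fun i => (√(l i))⁻¹ * √(l i)
  have hPP : P * P = P := by
    simp only [P, hE]
    congr 1
    ext i
    by_cases h : √(l i) = 0 <;> simp [h]
  have hPH : P.IsHermitian := hEH _
  refine ⟨s.submatrix id e, T.submatrix id e, P, ?_, ?_, hPH, hPP, ?_, ?_⟩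
  · rw [Matrix.conjTranspose_submatrix, Matrix.submatrix_mul_equiv, hEH, hE, hρE]
    simp [Real.mul_self_sqrt (hl _)]
  · rw [Matrix.conjTranspose_submatrix, Matrix.submatrix_mul_equiv, hEH, hE]
    rfl
  · rw [hρE, hE]
    congr 1
    ext i
    by_cases h : √(l i) = 0
    · simp [(Real.sqrt_eq_zero (hl i)).mp h]
    · simp [h]
  · have h1 : (T.submatrix id e)ᴴ * ρ * T.submatrix id e = P.submatrix e e := by
      have : T * ρ * T = P := by
        rw [hρE, hE, hE]
        congr 1
        ext i
        by_cases h : √(l i) = 0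
        · simp [h]
        · field_simp
          rw [Real.sq_sqrt (hl i)]
      have hT : Tᴴ = T := hEH _
      rw [Matrix.conjTranspose_submatrix, hT, ← this]
      rfl
    have h2 : (1 - P).PosSemidef := by
      have := Matrix.posSemidef_self_mul_conjTranspose (1 - P)
      rwa [(Matrix.isHermitian_one.sub hPH).eq, sub_mul, mul_sub, mul_sub, hPP, one_mul, one_mul,
        mul_one, sub_self, sub_zero] at this
    rw [h1, ← Matrix.submatrix_one_equiv e]
    exact h2.submatrix e

/-- The Weyl operators: a unitary operator basis. -/
theorem exists_unitary_basis (n : ℕ) [NeZero n] :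
    ∃ u : ZMod n × ZMod n → Matrix (ZMod n) (ZMod n) ℂ,
      (∀ b, (u b)ᴴ * u b = 1) ∧ ∀ i j k l,
        ∑ b, u b i j * star (u b k l) = if i = k ∧ j = l then (n : ℂ) else 0 := by
  let ψ := ZMod.stdAddChar (N := n)
  have hψ (z w : ZMod n) : star (ψ z) * ψ w = ψ (w - z) := by
    rw [sub_eq_neg_add, AddChar.map_add_eq_mul, AddChar.map_neg_eq_conj]
    rfl
  -- A phase given by the character `b.2`, followed by a shift by `b.1`. Summing over `b.2` uses
  -- orthogonality of characters; summing over `b.1` matches the shifts.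
  refine ⟨fun b => Matrix.of fun i j => if i = j + b.1 then ψ (b.2 * j) else 0,
    fun b => ?_, fun i j k l => ?_⟩
  · ext i j
    simp only [Matrix.mul_apply, Matrix.conjTranspose_apply, Matrix.of_apply, apply_ite star,
      star_zero, ite_mul, zero_mul, mul_ite, mul_zero, Finset.sum_ite_eq', Finset.mem_univ, if_true]
    by_cases h : i = j
    · subst h
      rw [if_pos rfl, hψ, sub_self, AddChar.map_zero_eq_one, Matrix.one_apply_eq]
    · rw [if_neg (by simpa using Ne.symm h), Matrix.one_apply_ne h]
  · have h3 : ∑ q : ZMod n, ψ (q * j) * star (ψ (q * l)) = if j = l then (n : ℂ) else 0 := by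
      have := AddChar.sum_mulShift (j - l) (ZMod.isPrimitive_stdAddChar n)
      simp only [ZMod.card, sub_eq_zero, Nat.cast_ite, Nat.cast_zero] at this
      rw [← this]
      refine Finset.sum_congr rfl fun q _ => ?_
      rw [mul_comm, hψ, mul_sub]
    calc _ = ∑ p : ZMod n, (if i - j = p ∧ k - l = p then 1 else 0) *
          ∑ q : ZMod n, ψ (q * j) * star (ψ (q * l)) := by
          rw [Fintype.sum_prod_type]
          refine Finset.sum_congr rfl fun p _ => ?_
          rw [Finset.mul_sum]
          refine Finset.sum_congr rfl fun q _ => ?_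
          simp only [Matrix.of_apply, sub_eq_iff_eq_add']
          by_cases h1 : i = j + p <;> by_cases h2 : k = l + p <;> simp [h1, h2]
      _ = _ := by
          rw [h3, ← Finset.sum_mul]
          by_cases hjl : j = l
          · subst hjl
            by_cases hik : i = k
            · subst hik
              simp
            · have (p : ZMod n) : ¬(i - j = p ∧ k - j = p) := fun ⟨h1, h2⟩ =>
                hik (sub_left_injective (h1.trans h2.symm))
              simp [hik, this]
          · simp [hjl]

/-- Finitely many states suffice for tomography. -/
theorem exists_tomographic_states (B : Type*) [Fintype B] :
    ∃ (n : ℕ) (ζ : Fin n → Matrix B B ℂ), (∀ y, IsState (ζ y)) ∧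
      ∀ Q Q' : Matrix B B ℂ, Q.IsHermitian → Q'.IsHermitian →
        (∀ y, (Q * ζ y).trace = (Q' * ζ y).trace) → Q = Q' := by
  obtain ⟨t, ht, hspan⟩ := Submodule.fg_span_iff_fg_span_finset_subset (R := ℂ)
    {ρ : Matrix B B ℂ | IsState ρ} |>.mp (IsNoetherian.noetherian _)
  refine ⟨t.card, fun y => (t.equivFin.symm y).1, fun y => ht (t.equivFin.symm y).2,
    fun Q Q' hQ hQ' h => ?_⟩
  have key (ρ) (hρ : IsState ρ) : ((Q - Q') * ρ).trace = 0 := by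
    have hmem : ρ ∈ Submodule.span ℂ (t : Set (Matrix B B ℂ)) := hspan ▸ Submodule.subset_span hρ
    clear hρ
    induction hmem using Submodule.span_induction with
    | mem σ hσ =>
      have := h (t.equivFin ⟨σ, hσ⟩)
      simp only [Equiv.symm_apply_apply] at this
      rw [sub_mul, Matrix.trace_sub, this, sub_self]
    | zero => simp
    | add σ τ _ _ h1 h2 => rw [mul_add, Matrix.trace_add, h1, h2, add_zero]
    | smul c σ _ h1 => rw [Matrix.mul_smul, Matrix.trace_smul, h1, smul_zero]
  -- The difference pairs to zero with every state, so it and its negative are both positive; its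
  -- trace is therefore zero.
  have h1 : (Q - Q').PosSemidef :=
    Matrix.posSemidef_of_forall_isState (hQ.sub hQ') fun ρ hρ => by simp [key ρ hρ]
  have h2 : (-(Q - Q')).PosSemidef :=
    Matrix.posSemidef_of_forall_isState (hQ.sub hQ').neg fun ρ hρ => by
      simp [-neg_sub, neg_mul, key ρ hρ]
  have h3 : (Q - Q').trace = 0 :=
    le_antisymm (by simpa [-neg_sub] using h2.trace_nonneg) h1.trace_nonneg
  exact sub_eq_zero.mp (h1.trace_eq_zero_iff.mp h3)

end LowerBound

/-! ### Behaviours as operators on Bob's input space -/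

section Steering

variable {V A X O : Type*} [Fintype V] [DecidableEq V] [Fintype A] [DecidableEq A] [Fintype O]
variable {W B Y P : Type*} [Fintype W] [DecidableEq W] [Fintype B] [DecidableEq B] [Fintype P]

theorem slice_kronecker_slice {m n : Type*} (D : Matrix (m × V) (m × V) ℂ)
    (E : Matrix (n × W) (n × W) ℂ) (w : Matrix V V ℂ) (z : Matrix W W ℂ) :
    slice D w ⊗ₖ slice E z =
      slice ((D ⊗ₖ E).submatrix (fun p : (m × n) × (W × V) => ((p.1.1, p.2.2), (p.1.2, p.2.1)))
        fun p => ((p.1.1, p.2.2), (p.1.2, p.2.1))) (z ⊗ₖ w) := by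
  ext i j
  simp only [slice, Matrix.kroneckerMap_apply, Matrix.of_apply, Matrix.submatrix_apply,
    Fintype.sum_prod_type, Finset.sum_mul, Finset.mul_sum]
  refine Finset.sum_congr rfl fun _ _ => Finset.sum_comm.trans ?_
  exact Finset.sum_congr rfl fun _ _ => Finset.sum_congr rfl fun _ _ =>
    Finset.sum_congr rfl fun _ _ => by ring

/-- A behaviour, as a function of Bob's quantum input, is given by operators on Bob's input system
that form an unnormalised generalised measurement set for each of Bob's outcomes. -/
theorem IsBuscemiBehaviour.exists_genCone {ω : X → Matrix V V ℂ} (hω : ∀ x, IsState (ω x))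
    {ζ : Y → Matrix W W ℂ} (hζ : ∀ y, IsState (ζ y)) {g : O → P → X → Y → ℝ}
    (hg : IsBuscemiBehaviour ω ζ g) :
    ∃ (Γ : P → O → X → Matrix W W ℂ) (τ : P → Matrix W W ℂ), (∀ b, GenCone ω (Γ b) (τ b)) ∧
      ∀ a b x y, (g a b x y : ℂ) = (Γ b a x * ζ y).trace := by
  obtain ⟨m, n, NA, NB, σ, hA, hB, hσ, rfl⟩ := hg
  have hA' := isGenMeasSet_iff_genCone.mp hA
  have hB' := isGenMeasSet_iff_genCone.mp hB
  obtain ⟨D, hD, hD1, hNA⟩ := id hA'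
  obtain ⟨E, hE, hE1, hNB⟩ := id hB'
  let f : (W × V) × (Fin m × Fin n) → (Fin m × V) × (Fin n × W) :=
    fun p => ((p.2.1, p.1.2), (p.2.2, p.1.1))
  -- Contracting the shared state first leaves operators on the two input spaces. Summing over
  -- Alice's outcomes turns D into 1, which leaves Bob's effect contracted with his reduced state:
  -- no-signalling makes the total a product τ ⊗ 1.
  let F (b : P) (a : O) : Matrix (W × V) (W × V) ℂ := slice ((D a ⊗ₖ E b).submatrix f f) σ
  refine ⟨fun b a x => slice (F b a) (ω x),
    fun b => slice ((E b).submatrix Prod.swap Prod.swap) (partialTraceFst σ),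
    fun b => ⟨F b, fun a => slice_posSemidef (((hD a).kronecker (hE b)).submatrix f) hσ.1, ?_,
      fun _ _ => rfl⟩, fun a b x y => ?_⟩
  · have h : ∑ a, (D a ⊗ₖ E b).submatrix f f =
        (((1 : Matrix (Fin m) (Fin m) ℂ) ⊗ₖ (1 : Matrix V V ℂ)) ⊗ₖ E b).submatrix f f := by
      rw [← hD1]
      ext i j
      simp [Matrix.sum_apply, Finset.sum_mul]
    rw [← slice_sum, h]
    ext ⟨w, v⟩ ⟨w', v'⟩
    simp only [slice, Matrix.of_apply, Matrix.submatrix_apply, Matrix.kroneckerMap_apply, f,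
      Fintype.sum_prod_type, partialTraceFst, Matrix.one_apply, Prod.swap, Finset.mul_sum, ite_mul, one_mul, zero_mul, Finset.sum_ite_irrel, Finset.sum_const_zero,
      Finset.sum_ite_eq, Finset.mem_univ, if_true, mul_ite, mul_one, mul_zero]
    by_cases hv : v = v'
    · rw [if_pos hv, if_pos hv, Finset.sum_comm]
      exact Finset.sum_congr rfl fun _ _ => Finset.sum_comm
    · rw [if_neg hv, if_neg hv]
  · rw [behaviour, ((hA'.posSemidef hω a x).kronecker (hB'.posSemidef hζ b y)).ofReal_re_trace_mul
      hσ.1, hNA, hNB, slice_kronecker_slice]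
    change _ = (slice (F b a) (ω x) * ζ y).trace
    rw [trace_slice_mul (F b a), ← trace_slice_mul_swap _ σ]
    rfl

/-- Bob's rank-one measurement of his input and his system in the basis given by `u`. -/
theorem isGenMeasSet_unitary_basis {u : P → Matrix B B ℂ}
    (hu : ∀ i j k l, ∑ b, u b i j * star (u b k l) = if i = k ∧ j = l then (Fintype.card B : ℂ) else 0)
    (ζ : Y → Matrix B B ℂ) :
    IsGenMeasSet ζ fun b y => ((Fintype.card B : ℝ)⁻¹ : ℂ) • ((u b)ᴴ * ζ y * u b)ᵀ := by
  rcases isEmpty_or_nonempty B with hB | hB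
  · refine ⟨fun _ => 0, ⟨fun _ => Matrix.PosSemidef.zero, Subsingleton.elim _ _⟩,
      fun _ _ => Subsingleton.elim _ _⟩
  refine isGenMeasSet_iff_genCone.mpr
    -- Rank-one operators on the vectorised `u b`; the relation `hu` is their completeness, up to
    -- the factor |B|.
    ⟨fun b => ((Fintype.card B : ℝ)⁻¹ : ℂ) • Matrix.vecMulVec (fun p : B × B => u b p.2 p.1)
      (star fun p : B × B => u b p.2 p.1), fun b => ?_, ?_, fun b y => ?_⟩
  · have := (Matrix.posSemidef_vecMulVec_self_star fun p : B × B => u b p.2 p.1).ofReal_smul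
      (c := (Fintype.card B : ℝ)⁻¹) (by positivity)
    rwa [Complex.ofReal_inv] at this
  · ext ⟨j, w⟩ ⟨j', w'⟩
    rw [← Finset.smul_sum, Matrix.smul_apply, Matrix.sum_apply, Matrix.one_kronecker_one]
    simp only [Matrix.vecMulVec_apply, Pi.star_apply, hu, Matrix.one_apply, Prod.mk.injEq,
      smul_eq_mul, and_comm (a := j = j')]
    split_ifs <;> simp
  · ext j j'
    simp only [Matrix.smul_apply, Matrix.transpose_apply, Matrix.mul_apply,
      Matrix.conjTranspose_apply, slice, Matrix.of_apply, Matrix.vecMulVec_apply, Pi.star_apply,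
      smul_eq_mul, Finset.mul_sum, Finset.sum_mul]
    exact Finset.sum_congr rfl fun _ _ => Finset.sum_congr rfl fun _ _ => by ring

/-- The pure state with coefficient matrix `s`. -/
def pureState (s : Matrix A B ℂ) : Matrix (A × B) (A × B) ℂ :=
  Matrix.vecMulVec (fun p => s p.1 p.2) (star fun p => s p.1 p.2)

theorem isState_pureState {s : Matrix A B ℂ} (hs : (s * sᴴ).trace = 1) : IsState (pureState s) := by
  refine ⟨Matrix.posSemidef_vecMulVec_self_star _, ?_⟩
  rw [← hs]
  simp [pureState, Matrix.trace, Matrix.vecMulVec_apply, Matrix.mul_apply, Fintype.sum_prod_type]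

theorem slice_pureState (s : Matrix A B ℂ) (Q : Matrix B B ℂ) :
    slice (pureState s) Qᵀ = s * Q * sᴴ := by
  ext i i'
  simp only [slice, pureState, Matrix.of_apply, Matrix.vecMulVec_apply, Pi.star_apply,
    Matrix.transpose_apply, Matrix.mul_apply, Matrix.conjTranspose_apply, Finset.sum_mul]
  rw [Finset.sum_comm]
  exact Finset.sum_congr rfl fun _ _ => Finset.sum_congr rfl fun _ _ => by ring

/-- The transpose trick for a pure state, followed by cyclicity of the trace, moves all operators
onto M and leaves a linear functional of Bob's input ζ. -/
theorem trace_kronecker_mul_pureState (s : Matrix A B ℂ) (M : Matrix A A ℂ) (u ζ : Matrix B B ℂ)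
    (c : ℂ) : ((M ⊗ₖ (c • (uᴴ * ζ * u)ᵀ)) * pureState s).trace =
      ((c • (u * sᴴ * M * (u * sᴴ)ᴴ)) * ζ).trace := by
  rw [trace_kronecker_mul, ← Matrix.transpose_smul, slice_pureState, Matrix.mul_smul,
    Matrix.smul_mul, Matrix.smul_mul, Matrix.smul_mul, Matrix.trace_smul, Matrix.trace_smul]
  congr 1
  rw [Matrix.conjTranspose_mul, Matrix.conjTranspose_conjTranspose,
    show s * (uᴴ * ζ * u) * sᴴ * M = (s * uᴴ) * (ζ * (u * sᴴ * M)) by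
      simp only [Matrix.mul_assoc], Matrix.trace_mul_comm,
    show ζ * (u * sᴴ * M) * (s * uᴴ) = ζ * (u * sᴴ * M * (s * uᴴ)) by
      simp only [Matrix.mul_assoc], Matrix.trace_mul_comm]

end Steering

/-! ### From a local model back to compatibility -/

section Attaining

variable {V A X O : Type*} [Fintype V] [DecidableEq V] [Fintype A] [DecidableEq A] [Fintype O]
variable {B I : Type*} [Fintype B] [DecidableEq B] [Fintype I]

/-- As ρ may be singular, only the compression PMP is under control. Pinching passes to M itself:
the padding on 1 - P is free because (1 - P)ρ = 0, and the factor 1 + η tends to 1. -/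
theorem robustnessI_le_of_pinched [Nonempty A] [Finite X] [Nonempty X] {ω : X → Matrix V V ℂ}
    (hω : ∀ x, IsState (ω x)) {M : O → X → Matrix A A ℂ} (hM : IsGenMeasSet ω M)
    {ρ : Matrix A A ℂ}
    (hopt : ∀ Z ∈ dominatingTotals ω M, 1 + robustnessI ω M ≤ (Z * ρ).trace.re)
    {P : Matrix A A ℂ} (hP : P.IsHermitian) (hPP : P * P = P) (hPρ : P * ρ = ρ)
    {N C : O → X → Matrix A A ℂ} {τ Z : Matrix A A ℂ} (hN : GenCone ω N τ) (hC : SepCone ω C Z)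
    (heq : ∀ a x, P * M a x * P + N a x = C a x) {r : ℝ} (hr : 0 ≤ r)
    (hZ : (Z * ρ).trace.re ≤ 1 + r) : robustnessI ω M ≤ r := by
  have := nonempty_outcomes hω hM
  have hM' := isGenMeasSet_iff_genCone.mp hM
  have hQP : P + (1 - P) = 1 := add_sub_cancel P 1
  have hQ : (1 - P).PosSemidef := by
    have := Matrix.posSemidef_self_mul_conjTranspose (1 - P)
    rwa [(Matrix.isHermitian_one.sub hP).eq, sub_mul, mul_sub, mul_sub, hPP, one_mul, one_mul,
      mul_one, sub_self, sub_zero] at this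
  have key (η : ℝ) (hη : 0 < η) : 1 + robustnessI ω M ≤ (1 + η) * (1 + r) := by
    have hη1 : (0 : ℝ) ≤ 1 + η := by positivity
    have hη2 : (0 : ℝ) ≤ 1 + η⁻¹ := by positivity
    have h1 := (genCone_pinching_sub hω hM' hQP hP hPP hη).add (hN.smul hη1)
    have h2 := (hC.smul hη1).add ((sepCone_const (O := O) hω hQ).smul hη2)
    have hmem := hopt _ ⟨_, _, h1, by
      convert! h2 using 1
      ext a x : 2
      simp only [Pi.add_apply, Pi.smul_apply, ← heq, smul_add]
      abel⟩
    refine hmem.trans ?_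
    rw [add_mul, Matrix.trace_add, Complex.add_re, Matrix.smul_mul, Matrix.trace_smul,
      Matrix.smul_mul, Matrix.smul_mul, sub_mul, hPρ, one_mul, sub_self, smul_zero, smul_zero,
      Matrix.trace_zero, Complex.zero_re, add_zero, smul_eq_mul, Complex.re_ofReal_mul]
    exact mul_le_mul_of_nonneg_left hZ hη1
  by_contra! hlt
  -- This η makes (1 + η)(1 + r) the midpoint of 1 + r and 1 + R_I, contradicting `key`.
  have h := key ((robustnessI ω M - r) / (2 * (1 + r))) (div_pos (by linarith) (by linarith))
  have : (1 + (robustnessI ω M - r) / (2 * (1 + r))) * (1 + r) =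
      (1 + r) + (robustnessI ω M - r) / 2 := by
    have : (1 + r) ≠ 0 := by linarith
    field_simp
  linarith

theorem robustnessI_le_of_steered [Nonempty A] [Finite X] [Nonempty X] {ω : X → Matrix V V ℂ}
    (hω : ∀ x, IsState (ω x)) {M : O → X → Matrix A A ℂ} (hM : IsGenMeasSet ω M)
    {ρ : Matrix A A ℂ}
    (hopt : ∀ Z ∈ dominatingTotals ω M, 1 + robustnessI ω M ≤ (Z * ρ).trace.re)
    {s T : Matrix A B ℂ} {P : Matrix A A ℂ} (hTs : T * sᴴ = P) (hP : P.IsHermitian)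
    (hPP : P * P = P) (hPρ : P * ρ = ρ) (hT : (1 - Tᴴ * ρ * T).PosSemidef)
    [Nonempty B] {u : I → Matrix B B ℂ} (hu : ∀ b, (u b)ᴴ * u b = 1)
    (hI : Fintype.card I = Fintype.card B * Fintype.card B)
    {Γ C : I → O → X → Matrix B B ℂ} {τ κ : I → Matrix B B ℂ} (hΓ : ∀ b, GenCone ω (Γ b) (τ b))
    (hC : ∀ b, SepCone ω (C b) (κ b)) (hκ : ∑ b, κ b = 1) {r : ℝ} (hr : 0 ≤ r)
    (heq : ∀ b a x, ((Fintype.card B : ℝ)⁻¹ : ℂ) • (u b * sᴴ * M a x * (u b * sᴴ)ᴴ) +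
      (r : ℂ) • Γ b a x = ((1 + r : ℝ) : ℂ) • C b a x) : robustnessI ω M ≤ r := by
  let d : ℝ := Fintype.card B
  have hd : 0 < d := by simp [d, Fintype.card_pos]
  have hdC : (d : ℂ) ≠ 0 := by exact_mod_cast hd.ne'
  -- Conjugation by R_b undoes both the unitary and √ρ, so each outcome b contributes the same
  -- PMP/d. Summing d² outcomes and dividing by d restores PMP.
  let R (b : I) : Matrix A B ℂ := T * (u b)ᴴ
  have hR (b : I) : R b * (u b * sᴴ) = P := by
    rw [Matrix.mul_assoc, ← Matrix.mul_assoc (u b)ᴴ, hu, Matrix.one_mul, hTs]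
  have hN := (GenCone.sum Finset.univ fun b => (hΓ b).conj (R b)).smul
    (c := d⁻¹ * r) (by positivity)
  have hC' := (SepCone.sum Finset.univ fun b => (hC b).conj (R b)).smul
    (c := d⁻¹ * (1 + r)) (by positivity)
  refine robustnessI_le_of_pinched hω hM hopt hP hPP hPρ hN hC' (fun a x => ?_) hr ?_
  · have hb (b : I) : (d : ℂ)⁻¹ • (P * M a x * P) + (r : ℂ) • (R b * Γ b a x * (R b)ᴴ) =
        ((1 + r : ℝ) : ℂ) • (R b * C b a x * (R b)ᴴ) := by
      have h := congrArg (fun Q => R b * Q * (R b)ᴴ) (heq b a x)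
      have h1 : R b * (u b * sᴴ * M a x * (u b * sᴴ)ᴴ) * (R b)ᴴ = P * M a x * P := by
        rw [show P * M a x * P = R b * (u b * sᴴ) * M a x * (R b * (u b * sᴴ))ᴴ by
          rw [hR, hP.eq]]
        simp only [Matrix.conjTranspose_mul, Matrix.mul_assoc]
      simp only [Matrix.mul_add, Matrix.add_mul, Matrix.mul_smul, Matrix.smul_mul, h1] at h
      exact h
    have hsum := Finset.sum_congr (rfl : (Finset.univ : Finset I) = Finset.univ) fun b _ => hb b
    rw [Finset.sum_add_distrib, Finset.sum_const, Finset.card_univ, hI,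
      ← Nat.cast_smul_eq_nsmul ℂ, smul_smul, ← Finset.smul_sum, ← Finset.smul_sum] at hsum
    have hdd : ((Fintype.card B * Fintype.card B : ℕ) : ℂ) * (d : ℂ)⁻¹ = d := by
      simp only [d, Nat.cast_mul, Complex.ofReal_natCast]
      exact mul_inv_cancel_right₀ (by simp) _
    rw [hdd] at hsum
    have := congrArg ((d : ℂ)⁻¹ • ·) hsum
    simp only [smul_add, inv_smul_smul₀ hdC, smul_smul] at this
    simp only [Pi.smul_apply, Finset.sum_apply, Complex.ofReal_mul, Complex.ofReal_inv]
    exact this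
  -- Cyclicity and T†ρT ≤ 1 give the bound; summed over b it yields tr 1 = d, which cancels the
  -- prefactor d⁻¹.
  · have hκb (b : I) : ((R b * κ b * (R b)ᴴ) * ρ).trace.re ≤ (κ b).trace.re := by
      have huu : u b * (u b)ᴴ = 1 := mul_eq_one_comm.mp (hu b)
      have h1 := (hC b).total_posSemidef.re_trace_mul_nonneg (hT.mul_mul_conjTranspose_same (u b))
      have h2 : ((R b * κ b * (R b)ᴴ) * ρ).trace =
          (κ b * (u b * (Tᴴ * ρ * T) * (u b)ᴴ)).trace := by
        rw [Matrix.mul_assoc, Matrix.mul_assoc, Matrix.trace_mul_comm]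
        simp only [R, Matrix.conjTranspose_mul, Matrix.conjTranspose_conjTranspose,
          Matrix.mul_assoc]
      rw [Matrix.mul_sub, Matrix.sub_mul, Matrix.mul_one, huu, Matrix.mul_sub, Matrix.mul_one,
        Matrix.trace_sub, ← h2, Complex.sub_re] at h1
      linarith
    have hsum : ((∑ b, R b * κ b * (R b)ᴴ) * ρ).trace.re ≤ d := by
      rw [Matrix.sum_mul, Matrix.trace_sum, Complex.re_sum]
      refine (Finset.sum_le_sum fun b _ => hκb b).trans ?_
      rw [← Complex.re_sum, ← Matrix.trace_sum, hκ]
      simp [d]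
    rw [Matrix.smul_mul, Matrix.trace_smul, smul_eq_mul, Complex.re_ofReal_mul]
    calc d⁻¹ * (1 + r) * _ ≤ d⁻¹ * (1 + r) * d := mul_le_mul_of_nonneg_left hsum (by positivity)
      _ = 1 + r := by field_simp

theorem robustnessI_le_of_mem_nonlocalityFeasible [Nonempty A] [Finite X] [Nonempty X]
    {ω : X → Matrix V V ℂ}
    (hω : ∀ x, IsState (ω x)) {M : O → X → Matrix A A ℂ} (hM : IsGenMeasSet ω M)
    {ρ : Matrix A A ℂ}
    (hopt : ∀ Z ∈ dominatingTotals ω M, 1 + robustnessI ω M ≤ (Z * ρ).trace.re)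
    {s T : Matrix A B ℂ} {P : Matrix A A ℂ} (hTs : T * sᴴ = P) (hP : P.IsHermitian)
    (hPP : P * P = P) (hPρ : P * ρ = ρ) (hT : (1 - Tᴴ * ρ * T).PosSemidef)
    [Nonempty B] {u : I → Matrix B B ℂ} (hu : ∀ b, (u b)ᴴ * u b = 1)
    (hI : Fintype.card I = Fintype.card B * Fintype.card B)
    {Y : Type*} {ζ : Y → Matrix B B ℂ} (hζ : ∀ y, IsState (ζ y))
    (htom : ∀ Q Q' : Matrix B B ℂ, Q.IsHermitian → Q'.IsHermitian →
      (∀ y, (Q * ζ y).trace = (Q' * ζ y).trace) → Q = Q') {r : ℝ}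
    (hr : r ∈ nonlocalityFeasible ω ζ (behaviour M
      (fun b y => ((Fintype.card B : ℝ)⁻¹ : ℂ) • ((u b)ᴴ * ζ y * u b)ᵀ) (pureState s))) :
    robustnessI ω M ≤ r := by
  obtain ⟨hr0, g, hg, k, q, H, K, hq, hH, hK, hloc⟩ := hr
  obtain ⟨Γ, τ, hΓ, hgΓ⟩ := hg.exists_genCone hω hζ
  have hM' := isGenMeasSet_iff_genCone.mp hM
  have hd : (0 : ℝ) ≤ (Fintype.card B : ℝ)⁻¹ := by positivity
  -- For fixed b the local model is a compatible family on Bob's input space with parent operators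
  -- q(l) K_{b|l}; over all b their totals add up to 1.
  let C (b : I) (a : O) (x : X) : Matrix B B ℂ :=
    ∑ l, (H l a * ω x).trace • ((q l : ℂ) • K l b)
  have hC (b : I) : SepCone ω (C b) (∑ l, (q l : ℂ) • K l b) :=
    SepCone.of_fintype _ H (fun l => ((hK l).1 b).ofReal_smul (hq.1 l)) hH
  refine robustnessI_le_of_steered hω hM hopt hTs hP hPP hPρ hT hu hI hΓ hC ?_ hr0
    fun b a x => ?_
  · rw [Finset.sum_comm]
    simp only [← Finset.smul_sum, (hK _).2]
    rw [← Finset.sum_smul, ← Complex.ofReal_sum, hq.2, Complex.ofReal_one, one_smul]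
  · have hS : (((Fintype.card B : ℝ)⁻¹ : ℂ) • (u b * sᴴ * M a x * (u b * sᴴ)ᴴ)).PosSemidef := by
      have := ((hM'.posSemidef hω a x).mul_mul_conjTranspose_same (u b * sᴴ)).ofReal_smul hd
      rwa [Complex.ofReal_inv] at this
    have hG := ((hΓ b).posSemidef hω a x).ofReal_smul hr0
    have hCb := (((hC b).genCone).posSemidef hω a x).ofReal_smul (c := 1 + r) (by linarith)
    -- Tomographic inputs lift the equality of probabilities to an equality of Hermitian operators.
    refine htom _ _ (hS.isHermitian.add hG.isHermitian) hCb.isHermitian fun y => ?_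
    have h := hloc a b x y
    beta_reduce at h
    rw [div_eq_iff (by linarith), behaviour, trace_kronecker_mul_pureState] at h
    have h' := congrArg (fun t : ℝ => (t : ℂ)) h
    simp only [Complex.ofReal_add, Complex.ofReal_mul, Complex.ofReal_sum, hgΓ,
      hS.ofReal_re_trace_mul (hζ y).1, ((hH _).1 a).ofReal_re_trace_mul (hω x).1,
      ((hK _).1 b).ofReal_re_trace_mul (hζ y).1] at h'
    rw [add_mul, Matrix.trace_add, Matrix.smul_mul (r : ℂ), Matrix.trace_smul, smul_eq_mul, h',
      Matrix.smul_mul, Matrix.trace_smul, Matrix.sum_mul, Matrix.trace_sum, smul_eq_mul,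
      Complex.ofReal_add, mul_comm]
    congr 1
    refine Finset.sum_congr rfl fun l _ => ?_
    rw [Matrix.smul_mul, Matrix.smul_mul, Matrix.trace_smul, Matrix.trace_smul, smul_eq_mul,
      smul_eq_mul]
    ring

end Attaining

/-! ### The equality and its maximiser -/

theorem mainTheorem3 {V A X O : Type*} [Fintype V] [DecidableEq V] [Fintype A] [DecidableEq A]
    [Nonempty A] [Finite X] [Nonempty X] [Fintype O]
    (ω : X → Matrix V V ℂ) (hω : ∀ x, IsState (ω x))
    (M : O → X → Matrix A A ℂ) (hM : IsGenMeasSet ω M) :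
    IsLeast (incompatibilityFeasible ω M) (robustnessI ω M) ∧
    (∀ S : BobChoice A, (nonlocalityFeasible ω S.ζ (behaviour M S.MB S.ρ)).Nonempty) ∧
    IsGreatest
      (Set.range fun S : BobChoice A => robustnessBN ω S.ζ (behaviour M S.MB S.ρ))
      (robustnessI ω M) := by
  have hleast := isLeast_robustnessI hω hM
  have hsub (S : BobChoice A) := incompatibilityFeasible_subset_nonlocalityFeasible hω M S.ζ_state
    S.MB_gen S.ρ_state
  have hle (S : BobChoice A) : robustnessBN ω S.ζ (behaviour M S.MB S.ρ) ≤ robustnessI ω M :=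
    csInf_le ⟨0, fun r hr => hr.1⟩ (hsub S hleast.1)
  refine ⟨hleast, fun S => ⟨_, hsub S hleast.1⟩, ?_, by rintro _ ⟨S, rfl⟩; exact hle S⟩
  obtain ⟨ρ, hρ, hopt⟩ := exists_isState_le_trace_dominatingTotals hω hM
  obtain ⟨n, hn⟩ := Nat.exists_eq_succ_of_ne_zero (Fintype.card_ne_zero (α := A))
  let e : Fin (n + 1) ≃ A := (Fintype.equivFinOfCardEq hn).symm
  obtain ⟨s, T, P, hs, hTs, hP, hPP, hPρ, hT⟩ := hρ.1.exists_support_factorization e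
  obtain ⟨u, hu, hbasis⟩ := exists_unitary_basis (n + 1)
  obtain ⟨i, ζ, hζ, htom⟩ := exists_tomographic_states (Fin (n + 1))
  -- The Weyl operators live on `ZMod (n + 1)` and are indexed by pairs; both are relabelled by
  -- `Fin`, as `BobChoice` demands.
  let e' : Fin (n + 1) ≃ ZMod (n + 1) := (Fintype.equivFinOfCardEq (ZMod.card _)).symm
  let f := Fintype.equivFin (ZMod (n + 1) × ZMod (n + 1))
  let v (b : Fin (Fintype.card (ZMod (n + 1) × ZMod (n + 1)))) :
    Matrix (Fin (n + 1)) (Fin (n + 1)) ℂ := (u (f.symm b)).submatrix e' e'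
  have hv (b) : (v b)ᴴ * v b = 1 := by
    rw [Matrix.conjTranspose_submatrix, Matrix.submatrix_mul_equiv, hu, Matrix.submatrix_one_equiv]
  have hvbasis (i j k l : Fin (n + 1)) : ∑ b, v b i j * star (v b k l) =
      if i = k ∧ j = l then (Fintype.card (Fin (n + 1)) : ℂ) else 0 := by
    have h := hbasis (e' i) (e' j) (e' k) (e' l)
    simp only [e'.injective.eq_iff] at h
    rw [Fintype.card_fin, ← h]
    exact f.symm.sum_comp fun b => u b (e' i) (e' j) * star (u b (e' k) (e' l))
  let S : BobChoice A := {
    dB := n + 1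
    dW := n + 1
    i := i
    o := _
    ρ := pureState s
    ζ := ζ
    MB := _
    ρ_state := isState_pureState (by rw [hs, hρ.2])
    ζ_state := hζ
    MB_gen := isGenMeasSet_unitary_basis hvbasis ζ }
  refine ⟨S, le_antisymm (hle S) (le_csInf ⟨_, hsub S hleast.1⟩ fun r hr => ?_)⟩
  exact robustnessI_le_of_mem_nonlocalityFeasible hω hM hopt hTs hP hPP hPρ hT hv
    (by simp [ZMod.card]) hζ htom hr
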